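/- Let $M$ be a smooth manifold. Let $\mathcal B^{(1)}=\mathrm{GL}(TM)$ be the Lie groupoid over $M$ of all linear isomorphisms $\xi:T_xM\to T_yM$ ($x,y\in M$), with source $\alpha(\xi)=x$ and target $\beta(\xi)=y$. A local bisection of $\mathcal B^{(1)}$ is a smooth map $b:U\to\mathcal B^{(1)}$ on an open set $U\subset M$ with $\alpha\circ b=\mathrm{id}$ such that $b^0=\beta\circ b$ is a diffeomorphism onto an open subset of $M$. The $(1,1)$-jets $j^1_xb$ of local bisections form a Lie groupoid over $M$, with source $x$, target $b^0(x)$ and product $j^1_yb'\cdot j^1_xb=j^1_x(b'\cdot b)$ for $y=b^0(x)$, where $(b'\cdot b)(x')=b'(b^0(x'))\circ b(x')$. Put $p(j^1_xb)=b(x)$ and $p_*(j^1_xb)=j^1_xb^0=b^0_{*x}$. The $(1,1)$-jets with $p=p_*$ are called semi-holonomic; they form a Lie subgroupoid $\mathcal B^{(1,1)}_{sh}$. A jet is called holonomic, or a genuine $2$-jet, if it equals $j^1_x(x'\mapsto f_{*x'})$ for some local diffeomorphism $f$ of $M$. A symmetry jet is a smooth map $\mathfrak s:M\to\mathcal B^{(1,1)}_{sh}$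 such that $\mathfrak s(x)$ has source $x$ and $p(\mathfrak s(x))=-I_x$, where $I_x=\mathrm{id}_{T_xM}$; it is called holonomic if all $\mathfrak s(x)$ are holonomic. For a local bisection $b$ and a vector field $Y$ let $bY$ be the local vector field $(bY)(b^0(x'))=b(x')(Y(x'))$. The symmetry jet $\mathfrak s$ determines the affine connection $$(\nabla^{\mathfrak s}_XY)_x=\tfrac12\,[X,\,Y+s_xY]_x,\qquad \mathfrak s(x)=j^1_xs_x .$$ A jet $j^1_xb\in\mathcal B^{(1,1)}_{sh}$ is called affine if $b(x)(\nabla^{\mathfrak s}_{X_x}Y)=\nabla^{\mathfrak s}_{b(x)(X_x)}(bY)$ for all vector fields $X,Y$ near $x$. **Proposition 3.3.** For every symmetry jet $\mathfrak s$ on $M$ there is a unique Lie groupoid morphism (smooth, and compatible with sources, targets, units and products) $S:\mathrm{GL}(TM)\to\mathcal B^{(1,1)}_{sh}$ such that $p\circ S=\mathrm{id}$ and $S(-I_x)=\mathfrak s(x)$ for all $x\in M$. The image of $S$ is exactly the set of affine jets. If $\mathfrak s$ is holonomic, then every $S(\xi)$ is a genuine $2$-jet. -/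

import Mathlib

open Set Bundle Manifold ContDiff Topology

noncomputable section

namespace JetGroupoid

/-! ### Fibrewise structure on pullback bundles -/

section Pullback

variable {B B' : Type*} {V : B → Type*} (f : B' → B)

instance pullbackAddCommGroup [∀ x, AddCommGroup (V x)] (x : B') : AddCommGroup ((f *ᵖ V) x) :=
  inferInstanceAs (AddCommGroup (V (f x)))

instance pullbackIsTopologicalAddGroup [∀ x, AddCommGroup (V x)] [∀ x, TopologicalSpace (V x)]
    [∀ x, IsTopologicalAddGroup (V x)] (x : B') : IsTopologicalAddGroup ((f *ᵖ V) x) :=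
  inferInstanceAs (IsTopologicalAddGroup (V (f x)))

instance pullbackContinuousSMul [∀ x, AddCommGroup (V x)] [∀ x, Module ℝ (V x)]
    [∀ x, TopologicalSpace (V x)] [∀ x, ContinuousSMul ℝ (V x)] (x : B') :
    ContinuousSMul ℝ ((f *ᵖ V) x) :=
  inferInstanceAs (ContinuousSMul ℝ (V (f x)))

end Pullback

/-! ### The manifold of 1-jets of maps between two manifolds -/

section OneJet

variable {E : Type*} [NormedAddCommGroup E] [NormedSpace ℝ E]
  {H : Type*} [TopologicalSpace H] (I : ModelWithCorners ℝ E H)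
  (M : Type*) [TopologicalSpace M] [ChartedSpace H M] [IsManifold I ∞ M]
  {E' : Type*} [NormedAddCommGroup E'] [NormedSpace ℝ E']
  {H' : Type*} [TopologicalSpace H'] (I' : ModelWithCorners ℝ E' H')
  (N : Type*) [TopologicalSpace N] [ChartedSpace H' N] [IsManifold I' ∞ N]

/-- The bundle `pr₁^* TM` over `M × N`, with fibre `T_x M` at `(x, y)`. -/
abbrev SourceBundle : M × N → Type _ :=
  (ContMDiffMap.fst : C^∞⟮I.prod I', M × N; I, M⟯) *ᵖ (TangentSpace I : M → Type _)

/-- The bundle `pr₂^* TN` over `M × N`, with fibre `T_y N` at `(x, y)`. -/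
abbrev TargetBundle : M × N → Type _ :=
  (ContMDiffMap.snd : C^∞⟮I.prod I', M × N; I', N⟯) *ᵖ (TangentSpace I' : N → Type _)

/-- The space `J¹(M, N)` of 1-jets of maps from `M` to `N`, that is of triples `((x, y), φ)` with
`φ : T_x M → T_y N` linear.  It is the total space of the smooth vector bundle
`Hom(pr₁^* TM, pr₂^* TN)` over `M × N`, and the instances below give it Mathlib's structure of a
smooth manifold on this total space. -/
def OneJet : Type _ :=
  TotalSpace (E →L[ℝ] E') (fun p => SourceBundle I M I' N p →L[ℝ] TargetBundle I M I' N p)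

/-- The model with corners of the manifold `J¹(M, N)`. -/
abbrev oneJetModel : ModelWithCorners ℝ ((E × E') × (E →L[ℝ] E'))
    (ModelProd (ModelProd H H') (E →L[ℝ] E')) :=
  (I.prod I').prod 𝓘(ℝ, E →L[ℝ] E')

instance OneJet.topologicalSpace : TopologicalSpace (OneJet I M I' N) :=
  inferInstanceAs (TopologicalSpace (TotalSpace (E →L[ℝ] E')
    (fun p => SourceBundle I M I' N p →L[ℝ] TargetBundle I M I' N p)))

instance OneJet.chartedSpace :
    ChartedSpace (ModelProd (ModelProd H H') (E →L[ℝ] E')) (OneJet I M I' N) :=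
  inferInstanceAs (ChartedSpace (ModelProd (ModelProd H H') (E →L[ℝ] E'))
    (TotalSpace (E →L[ℝ] E')
      (fun p => SourceBundle I M I' N p →L[ℝ] TargetBundle I M I' N p)))

instance OneJet.isManifold : IsManifold (oneJetModel I I') ∞ (OneJet I M I' N) :=
  inferInstanceAs (IsManifold ((I.prod I').prod 𝓘(ℝ, E →L[ℝ] E')) ∞
    (TotalSpace (E →L[ℝ] E')
      (fun p => SourceBundle I M I' N p →L[ℝ] TargetBundle I M I' N p)))

variable {M N}

/-- The 1-jet given by a linear map `φ : T_x M → T_y N`. -/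
def OneJet.of (x : M) (y : N) (φ : TangentSpace I x →L[ℝ] TangentSpace I' y) :
    OneJet I M I' N :=
  TotalSpace.mk (x, y) φ

variable {I I'}

/-- The source `x` of a 1-jet `φ : T_x M → T_y N`. -/
def OneJet.src (ξ : OneJet I M I' N) : M := (TotalSpace.proj ξ).1

/-- The target `y` of a 1-jet `φ : T_x M → T_y N`. -/
def OneJet.tgt (ξ : OneJet I M I' N) : N := (TotalSpace.proj ξ).2

/-- The linear part `φ : T_x M → T_y N` of a 1-jet. -/
def OneJet.lin (ξ : OneJet I M I' N) : TangentSpace I ξ.src →L[ℝ] TangentSpace I' ξ.tgt :=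
  TotalSpace.snd ξ

variable (I I')

/-- The 1-jet `j¹_x f = (x, f(x), f_{*x})` of a map `f` at a point `x`. -/
def jetAt (f : M → N) (x : M) : OneJet I M I' N :=
  OneJet.of I I' x (f x) (mfderiv I I' f x)

end OneJet

variable (E : Type*) [NormedAddCommGroup E] [NormedSpace ℝ E]
  (M : Type*) [TopologicalSpace M] [ChartedSpace E M] [IsManifold 𝓘(ℝ, E) ∞ M]

/-! ### The general linear groupoid of the tangent bundle -/

/-- The manifold `J¹(M, M)`. -/
abbrev J1 : Type _ := OneJet 𝓘(ℝ, E) M 𝓘(ℝ, E) M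

/-- The model with corners of `J¹(M, M)`. -/
abbrev J1model := oneJetModel 𝓘(ℝ, E) 𝓘(ℝ, E)

/-- The manifold `J¹(M, J¹(M, M))`. -/
abbrev J11 : Type _ := OneJet 𝓘(ℝ, E) M (J1model E) (J1 E M)

/-- The model with corners of `J¹(M, J¹(M, M))`. -/
abbrev J11model := oneJetModel 𝓘(ℝ, E) (J1model E)

/-- Invertibility of the linear part is an open condition on 1-jets. -/
theorem isOpen_invertible [FiniteDimensional ℝ E] :
    IsOpen {ξ : J1 E M | ξ.lin.IsInvertible} := by
  have : CompleteSpace E := FiniteDimensional.complete ℝ E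
  change IsOpen {ξ : TotalSpace (E →L[ℝ] E) (fun p : M × M =>
    SourceBundle 𝓘(ℝ, E) M 𝓘(ℝ, E) M p →L[ℝ] TargetBundle 𝓘(ℝ, E) M 𝓘(ℝ, E) M p) |
    ContinuousLinearMap.IsInvertible ξ.2}
  rw [isOpen_iff_mem_nhds]
  intro ξ₀ h₀
  set e := trivializationAt (E →L[ℝ] E) (fun p : M × M =>
    SourceBundle 𝓘(ℝ, E) M 𝓘(ℝ, E) M p →L[ℝ] TargetBundle 𝓘(ℝ, E) M 𝓘(ℝ, E) M p) ξ₀.proj with he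
  have key : ∀ ξ ∈ e.source,
      (ContinuousLinearMap.IsInvertible ξ.2 ↔ (e ξ).2.IsInvertible) := by
    intro ξ hξ
    rw [he, hom_trivializationAt_source] at hξ
    obtain ⟨h1, h2⟩ := hξ
    rw [he, hom_trivializationAt_apply]
    simp only
    rw [ContinuousLinearMap.inCoordinates_eq h1 h2]
    simp
  have hs : e.source ∈ 𝓝 ξ₀ := e.open_source.mem_nhds (by
    rw [he]; exact FiberBundle.mem_trivializationAt_proj_source)
  have hc : ContinuousAt (fun ξ => (e ξ).2) ξ₀ :=
    (e.continuousOn.continuousAt hs).snd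
  have hinv : {φ : E →L[ℝ] E | φ.IsInvertible} ∈ 𝓝 (e ξ₀).2 :=
    (ContinuousLinearEquiv.isOpen (𝕜 := ℝ) (E := E) (F := E)).mem_nhds
      ((key ξ₀ (mem_of_mem_nhds hs)).1 h₀)
  filter_upwards [hs, hc hinv] with ξ h1 h2
  exact (key ξ h1).2 h2

/-- The groupoid `𝓑⁽¹⁾(Pair(M)) = GL(TM)` of 1-jets of local diffeomorphisms of `M`, that is of
linear isomorphisms between tangent spaces of `M`, as an open submanifold of `J¹(M, M)`. -/
def GLTM [FiniteDimensional ℝ E] : TopologicalSpace.Opens (J1 E M) :=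
  ⟨{ξ : J1 E M | ξ.lin.IsInvertible}, isOpen_invertible E M⟩

variable {E M} in
/-- The element of `GL(TM)` given by a linear isomorphism `φ : T_x M → T_y M`. -/
def GLTM.of [FiniteDimensional ℝ E] {x y : M}
    (φ : TangentSpace 𝓘(ℝ, E) x ≃L[ℝ] TangentSpace 𝓘(ℝ, E) y) : GLTM E M :=
  ⟨OneJet.of 𝓘(ℝ, E) 𝓘(ℝ, E) x y φ, ⟨φ, rfl⟩⟩

/-! ### Local bisections of `GL(TM)` and their 1-jets -/

/-- A smooth local bisection `b` of `GL(TM)`: a diffeomorphism `b⁰ : U → V` between open subsets of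
`M` (the composition of `b` with the target map) together with a family, smooth on `U`, of linear
isomorphisms `b(x) : T_x M → T_{b⁰(x)} M`, `x ∈ U`.  The values outside `U` are irrelevant. -/
structure LocalBisection where
  /-- the underlying local diffeomorphism `b⁰ = β ∘ b` -/
  base : PartialDiffeomorph 𝓘(ℝ, E) 𝓘(ℝ, E) M M ∞
  /-- the linear isomorphism `b(x)` -/
  lin : ∀ x : M, TangentSpace 𝓘(ℝ, E) x →L[ℝ] TangentSpace 𝓘(ℝ, E) (base x)
  invertible : ∀ x ∈ base.source, (lin x).IsInvertible
  smooth : ContMDiffOn 𝓘(ℝ, E) (J1model E) ∞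
    (fun x => OneJet.of 𝓘(ℝ, E) 𝓘(ℝ, E) x (base x) (lin x)) base.source

variable {E M}

namespace LocalBisection

/-- A local bisection as a map `x ↦ b(x)` into `J¹(M, M)`. -/
def toJ1 (b : LocalBisection E M) (x : M) : J1 E M :=
  OneJet.of 𝓘(ℝ, E) 𝓘(ℝ, E) x (b.base x) (b.lin x)

/-- The `(1,1)`-jet `j¹_x b`. -/
def jet (b : LocalBisection E M) (x : M) : J11 E M :=
  jetAt 𝓘(ℝ, E) (J1model E) b.toJ1 x

/-- The product `x ↦ b₂(b₁⁰(x)) · b₁(x)` of two local bisections. -/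
def mul (b₂ b₁ : LocalBisection E M) (x : M) : J1 E M :=
  OneJet.of 𝓘(ℝ, E) 𝓘(ℝ, E) x (b₂.base (b₁.base x)) ((b₂.lin (b₁.base x)).comp (b₁.lin x))

/-- The image `bY` of a vector field `Y` under a local bisection `b`, defined on the target `V` of
`b⁰` by `(bY)(y) = b(x) (Y(x))` with `x = (b⁰)⁻¹(y)`. -/
def push (b : LocalBisection E M) (Y : ∀ x : M, TangentSpace 𝓘(ℝ, E) x) :
    ∀ y : M, TangentSpace 𝓘(ℝ, E) y :=
  fun y => (b.lin (b.base.symm y) (Y (b.base.symm y)) : E)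

/-- `b` is a holonomic bisection: `b = j¹ f` on the domain of `f = b⁰`. -/
def IsHolonomic (b : LocalBisection E M) : Prop :=
  ∀ x ∈ b.base.source, b.lin x = mfderiv 𝓘(ℝ, E) 𝓘(ℝ, E) b.base x

end LocalBisection

/-! ### `(1,1)`-jets -/

/-- `b` is a local bisection defined near the source `x` of `A`, and `A = j¹_x b`. -/
def Represents (b : LocalBisection E M) (A : J11 E M) : Prop :=
  A.src ∈ b.base.source ∧ b.jet A.src = A

variable (E M) in
/-- The set `𝓑⁽¹˒¹⁾(Pair(M))` of 1-jets of local bisections of `GL(TM)`. -/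
def B11 : Set (J11 E M) := {A | ∃ b : LocalBisection E M, Represents b A}

/-- The projection `p : j¹_x b ↦ b(x)`. -/
def p (A : J11 E M) : J1 E M := A.tgt

/-- The projection `p_* : j¹_x b ↦ j¹_x b⁰`, where `b⁰ = β ∘ b` and `β` is the target map of
`GL(TM)`; it sends `(x, ξ, D)` to `(x, β(ξ), β_{*ξ} ∘ D)`. -/
def pStar (A : J11 E M) : J1 E M :=
  OneJet.of 𝓘(ℝ, E) 𝓘(ℝ, E) A.src A.tgt.tgt
    ((mfderiv (J1model E) 𝓘(ℝ, E) (fun ξ : J1 E M => ξ.tgt) A.tgt).comp A.lin)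

variable (E M) in
/-- The set of semi-holonomic `(1,1)`-jets: those with `p = p_*`.  It is an embedded submanifold of
`J¹(M, J¹(M, M))`, so that a map into it is smooth exactly when it is smooth as a map into
`J¹(M, J¹(M, M))`. -/
def SemiHolonomic : Set (J11 E M) := {A | A ∈ B11 E M ∧ p A = pStar A}

/-- `A` is holonomic, i.e. a genuine 2-jet `j²_x f = j¹_x (j¹ f)` of a local diffeomorphism `f`. -/
def IsHolonomic (A : J11 E M) : Prop :=
  ∃ b : LocalBisection E M, b.IsHolonomic ∧ Represents b A

/-- The graph of the groupoid multiplication of `(1,1)`-jets: `A = A₂ · A₁`, where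
`j¹_y b₂ · j¹_x b₁ = j¹_x (b₂ · b₁)` for `y = b₁⁰(x)`. -/
def IsProduct (A₂ A₁ A : J11 E M) : Prop :=
  ∃ b₂ b₁ : LocalBisection E M, Represents b₁ A₁ ∧ Represents b₂ A₂ ∧
    A₂.src = b₁.base A₁.src ∧
    A = jetAt 𝓘(ℝ, E) (J1model E) (b₂.mul b₁) A₁.src

/-- The identity `j¹_x ε` of the groupoid of `(1,1)`-jets at `x`, where `ε(x) = id_{T_x M}`. -/
def unit (x : M) : J11 E M :=
  jetAt 𝓘(ℝ, E) (J1model E)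
    (fun x' : M => OneJet.of 𝓘(ℝ, E) 𝓘(ℝ, E) x' x' (ContinuousLinearMap.id ℝ _)) x

/-! ### Symmetry jets, their connections, affine jets -/

variable (E M) in
/-- A symmetry jet: a smooth section `𝔰` of the source map on semi-holonomic `(1,1)`-jets whose
first order part is `-I`. -/
structure SymmetryJet where
  toFun : M → SemiHolonomic E M
  smooth : ContMDiff 𝓘(ℝ, E) (J11model E) ∞ (fun x => (toFun x : J11 E M))
  source_eq : ∀ x, (toFun x : J11 E M).src = x
  p_eq : ∀ x, p (toFun x : J11 E M) =
    OneJet.of 𝓘(ℝ, E) 𝓘(ℝ, E) x x (-ContinuousLinearMap.id ℝ (TangentSpace 𝓘(ℝ, E) x))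

namespace SymmetryJet

/-- A symmetry jet is holonomic if all its values are genuine 2-jets. -/
def IsHolonomic (s : SymmetryJet E M) : Prop :=
  ∀ x, JetGroupoid.IsHolonomic (s.toFun x : J11 E M)

/-- A local bisection `s_x` with `j¹_x s_x = 𝔰(x)`. -/
def rep (s : SymmetryJet E M) (x : M) : LocalBisection E M :=
  Classical.choose (s.toFun x).2.1

/-- The affine connection `∇^𝔰` of a symmetry jet,
`(∇^𝔰_X Y)_x = ½ [X, Y + s_x(Y)]_x`, where `𝔰(x) = j¹_x s_x`.  (The value only depends on the
jet `𝔰(x)`, not on the chosen bisection `s_x`.) -/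
def nabla (s : SymmetryJet E M) (X Y : ∀ x : M, TangentSpace 𝓘(ℝ, E) x) (x : M) :
    TangentSpace 𝓘(ℝ, E) x :=
  (1 / 2 : ℝ) • VectorField.mlieBracket 𝓘(ℝ, E) X (Y + (s.rep x).push Y) x

end SymmetryJet

/-- `X` is a smooth vector field near `x`. -/
def SmoothNear (X : ∀ x : M, TangentSpace 𝓘(ℝ, E) x) (x : M) : Prop :=
  ∃ U ∈ 𝓝 x, ContMDiffOn 𝓘(ℝ, E) (𝓘(ℝ, E)).tangent ∞
    (fun x' => (⟨x', X x'⟩ : TangentBundle 𝓘(ℝ, E) M)) U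

/-- A semi-holonomic `(1,1)`-jet `A = j¹_x b` is affine for `∇^𝔰` if
`b(x)(∇_{X_x} Y) = ∇_{b(x)(X_x)} (bY)` for all local vector fields `X`, `Y` near `x`.  Here
`X'` is any local vector field extending `b(x)(X_x)`. -/
def IsAffine (s : SymmetryJet E M) (A : SemiHolonomic E M) : Prop :=
  ∀ b : LocalBisection E M, Represents b (A : J11 E M) →
    ∀ x : M, x = (A : J11 E M).src →
    ∀ X Y X' : ∀ x : M, TangentSpace 𝓘(ℝ, E) x,
      SmoothNear X x → SmoothNear Y x → SmoothNear X' (b.base x) →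
      X' (b.base x) = b.lin x (X x) →
      b.lin x (s.nabla X Y x) = s.nabla X' (b.push Y) (b.base x)

/-! ### Lie groupoid morphisms -/

/-- `S` is a morphism of Lie groupoids over `M` from `GL(TM)` to the groupoid of semi-holonomic
`(1,1)`-jets: it is smooth, and compatible with source, target, units and products. -/
structure IsLieGroupoidMorphism [FiniteDimensional ℝ E] (S : GLTM E M → SemiHolonomic E M) :
    Prop where
  smooth : ContMDiff (J1model E) (J11model E) ∞ (fun ξ => (S ξ : J11 E M))
  source_eq : ∀ ξ : GLTM E M, (S ξ : J11 E M).src = (ξ : J1 E M).src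
  target_eq : ∀ ξ : GLTM E M, (S ξ : J11 E M).tgt.tgt = (ξ : J1 E M).tgt
  map_unit : ∀ x : M,
    (S (GLTM.of (ContinuousLinearEquiv.refl ℝ (TangentSpace 𝓘(ℝ, E) x))) : J11 E M) = unit x
  map_mul : ∀ (x y z : M) (φ : TangentSpace 𝓘(ℝ, E) x ≃L[ℝ] TangentSpace 𝓘(ℝ, E) y)
    (ψ : TangentSpace 𝓘(ℝ, E) y ≃L[ℝ] TangentSpace 𝓘(ℝ, E) z),
    IsProduct (S (GLTM.of ψ) : J11 E M) (S (GLTM.of φ) : J11 E M)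
      (S (GLTM.of (φ.trans ψ)) : J11 E M)

/-- `S` is an affine extension of `𝔰`: a Lie groupoid morphism that is a section of `p` and
satisfies `S(-I_x) = 𝔰(x)` for all `x`. -/
structure IsAffineExtension [FiniteDimensional ℝ E] (s : SymmetryJet E M)
    (S : GLTM E M → SemiHolonomic E M) : Prop where
  morphism : IsLieGroupoidMorphism S
  section_p : ∀ ξ : GLTM E M, p (S ξ : J11 E M) = ξ
  extends_s : ∀ x : M,
    S (GLTM.of (ContinuousLinearEquiv.neg ℝ : TangentSpace 𝓘(ℝ, E) x ≃L[ℝ] TangentSpace 𝓘(ℝ, E) x))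
      = s.toFun x

end JetGroupoid

end

/-!
The point is that a semi-holonomic `(1,1)`-jet has a Hessian.  In charts, such a jet `A` over a
linear isomorphism `ξ : T_x M → T_y M` with expression `φ` is the jet of a pair of maps `(β, Φ)`,
where `β` has derivative `φ` and `Φ` has value `φ` and derivative `B` at `x`.  The bilinear map
`B`, which is arbitrary, determines `A` (`SemiHolonomic.ext`, `exists_semiHolonomic`), and `A` is
a genuine 2-jet exactly if `B` is symmetric.  The product of jets satisfies
`B(v, w) = φ₂ B₁(v, w) + B₂(φ₁ v, φ₁ w)` (`coordD_mul`).

Let `σ_x` be the Hessian of `𝔰(x)`.  Since `-I` is central in `GL(TM)`, a morphism `S` with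
`S(-I_x) = 𝔰(x)` satisfies `S(ξ) · 𝔰(x) = 𝔰(y) · S(ξ)`.  In charts, this is a linear equation for
the Hessian of `S(ξ)`, with the unique solution `B(v, w) = ½ (σ_y(φ v, φ w) - φ σ_x(v, w))`
(`SymmetryJet.commute_iff`).  This gives uniqueness.  Conversely, the solution is the same jet in
all charts, as the equation does not involve charts; it is smooth in `ξ`; and it is compatible
with units and products by the formula for the Hessian of a product
(`SymmetryJet.isAffineExtension`).

The connection of `𝔰` is `∇_X Y = DY(X) - ½ σ(X, Y)` in charts (`SymmetryJet.chartD_nabla`): the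
field `Y + s_x Y` vanishes at `x`, so that its bracket with `X` is its derivative.  If `b`
represents `A`, then `D(bY)(φ X) = B(X, Y) + φ DY(X)` at the target, and the condition that `A` is
affine becomes the formula for `B` above (`SymmetryJet.nabla_push_iff`).

If `𝔰` is holonomic, then `σ` is symmetric as a second derivative (`IsHolonomic.coordHess_symm`),
hence so is the Hessian `B` of `S(ξ)`, which is therefore the 2-jet of the quadratic map
`u ↦ φ u + ½ B(u, u)` (`SymmetryJet.isHolonomic_extension`).
-/

noncomputable section

namespace JetGroupoid

set_option linter.unusedSectionVars false

/-! ### Trivializations of the bundle of linear maps -/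

section InCoordinates

variable {E : Type*} [NormedAddCommGroup E] [NormedSpace ℝ E]
  {H : Type*} [TopologicalSpace H] (I : ModelWithCorners ℝ E H)
  {M : Type*} [TopologicalSpace M] [ChartedSpace H M] [IsManifold I ∞ M]
  {E' : Type*} [NormedAddCommGroup E'] [NormedSpace ℝ E']
  {H' : Type*} [TopologicalSpace H'] (I' : ModelWithCorners ℝ E' H')
  {N : Type*} [TopologicalSpace N] [ChartedSpace H' N] [IsManifold I' ∞ N]

/-- The trivializations of `pr₁^* TM` are those of `TM`, read at the first component. -/
theorem symmL_sourceBundle {x₀ x : M} (y₀ y : N) (hx : x ∈ (chartAt H x₀).source) :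
    (Trivialization.symmL ℝ
      (trivializationAt E (SourceBundle I M I' N) (x₀, y₀)) (x, y) : E →L[ℝ] E) =
    Trivialization.symmL ℝ (trivializationAt E (TangentSpace I : M → Type _) x₀) x := by
  ext v
  set e := trivializationAt E (TangentSpace I : M → Type _) x₀
  set e' := trivializationAt E (SourceBundle I M I' N) (x₀, y₀)
  have h1 := e.symmL_continuousLinearMapAt (R := ℝ) (b := x) hx (e'.symmL ℝ (x, y) v)
  have h2 : e.continuousLinearMapAt ℝ x (e'.symmL ℝ (x, y) v) = v :=
    e'.continuousLinearMapAt_symmL (R := ℝ) (b := (x, y)) hx v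
  rw [h2] at h1
  exact h1.symm

/-- The trivializations of the bundle `Hom(pr₁^* TM, pr₂^* TN)` read a linear map in the
coordinates given by the differentials of the charts. -/
theorem inCoordinates_oneJet {x₀ x : M} {y₀ y : N} (hx : x ∈ (chartAt H x₀).source)
    (hy : y ∈ (chartAt H' y₀).source) (φ : E →L[ℝ] E') :
    ContinuousLinearMap.inCoordinates E (SourceBundle I M I' N) E' (TargetBundle I M I' N)
      (x₀, y₀) (x, y) (x₀, y₀) (x, y) φ =
    (mfderiv I' 𝓘(ℝ, E') (extChartAt I' y₀) y : E' →L[ℝ] E').comp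
      (φ.comp (mfderivWithin 𝓘(ℝ, E) I (extChartAt I x₀).symm (range I) (extChartAt I x₀ x) :
        E →L[ℝ] E)) := by
  have h3 := TangentBundle.continuousLinearMapAt_trivializationAt (I := I') hy
  have h4 := TangentBundle.symmL_trivializationAt (I := I) hx
  change (Trivialization.continuousLinearMapAt ℝ
    (trivializationAt E' (TangentSpace I' : N → Type _) y₀) y : E' →L[ℝ] E').comp
      (φ.comp (Trivialization.symmL ℝ
        (trivializationAt E (SourceBundle I M I' N) (x₀, y₀)) (x, y) : E →L[ℝ] E)) = _
  rw [symmL_sourceBundle I I' _ _ hx, h3, h4]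
  rfl

end InCoordinates

variable {E : Type*} [NormedAddCommGroup E] [NormedSpace ℝ E]
  {M : Type*} [TopologicalSpace M] [ChartedSpace E M] [IsManifold 𝓘(ℝ, E) ∞ M]

/-! ### Jets as linear maps between model spaces -/

/-- The 1-jet `(x, y, φ)`, with `φ` regarded as an endomorphism of the model space. -/
def mk1 (x y : M) (φ : E →L[ℝ] E) : J1 E M := OneJet.of 𝓘(ℝ, E) 𝓘(ℝ, E) x y φ

/-- The linear part of a 1-jet, regarded as an endomorphism of the model space. -/
def OneJet.endo (ξ : J1 E M) : E →L[ℝ] E := ξ.lin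

@[simp] theorem mk1_src (x y : M) (φ : E →L[ℝ] E) : (mk1 x y φ).src = x := rfl
@[simp] theorem mk1_tgt (x y : M) (φ : E →L[ℝ] E) : (mk1 x y φ).tgt = y := rfl
@[simp] theorem mk1_endo (x y : M) (φ : E →L[ℝ] E) : (mk1 x y φ).endo = φ := rfl
/-- The `(1,1)`-jet `(x, ξ, D)`, with `D` regarded as a linear map between model spaces. -/
def mk2 (x : M) (ξ : J1 E M) (D : E →L[ℝ] (E × E) × (E →L[ℝ] E)) : J11 E M :=
  OneJet.of 𝓘(ℝ, E) (J1model E) x ξ D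

/-- The linear part of a `(1,1)`-jet, regarded as a linear map between model spaces. -/
def jetLin (A : J11 E M) : E →L[ℝ] (E × E) × (E →L[ℝ] E) := A.lin

theorem mk2_eta (A : J11 E M) : mk2 A.src A.tgt (jetLin A) = A := rfl

theorem contMDiff_src : ContMDiff (J1model E) 𝓘(ℝ, E) ∞ (fun ξ : J1 E M => ξ.src) :=
  contMDiff_fst.comp (Bundle.contMDiff_proj (𝕜 := ℝ) (F := E →L[ℝ] E)
    (IB := 𝓘(ℝ, E).prod 𝓘(ℝ, E)) (fun p : M × M => SourceBundle 𝓘(ℝ, E) M 𝓘(ℝ, E) M p →L[ℝ]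
      TargetBundle 𝓘(ℝ, E) M 𝓘(ℝ, E) M p))

theorem contMDiff_tgt : ContMDiff (J1model E) 𝓘(ℝ, E) ∞ (fun ξ : J1 E M => ξ.tgt) :=
  contMDiff_snd.comp (Bundle.contMDiff_proj (𝕜 := ℝ) (F := E →L[ℝ] E)
    (IB := 𝓘(ℝ, E).prod 𝓘(ℝ, E)) (fun p : M × M => SourceBundle 𝓘(ℝ, E) M 𝓘(ℝ, E) M p →L[ℝ]
      TargetBundle 𝓘(ℝ, E) M 𝓘(ℝ, E) M p))

/-! ### The charts of `J¹(M, M)` -/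

/-- The differential at `x` of the chart around `x₀`. -/
def chartD (x₀ x : M) : E →L[ℝ] E := mfderiv 𝓘(ℝ, E) 𝓘(ℝ, E) (extChartAt 𝓘(ℝ, E) x₀) x

/-- The inverse of the differential at `x` of the chart around `x₀`. -/
def chartDSymm (x₀ x : M) : E →L[ℝ] E :=
  mfderiv 𝓘(ℝ, E) 𝓘(ℝ, E) (extChartAt 𝓘(ℝ, E) x₀).symm (extChartAt 𝓘(ℝ, E) x₀ x)

theorem chartD_comp_chartDSymm {x₀ x : M} (hx : x ∈ (chartAt E x₀).source) :
    (chartD x₀ x).comp (chartDSymm x₀ x) = ContinuousLinearMap.id ℝ E := by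
  have := mfderiv_extChartAt_comp_mfderivWithin_extChartAt_symm' (I := 𝓘(ℝ, E)) (x := x₀) (y := x)
    (by simpa using hx)
  rw [modelWithCornersSelf_coe, range_id, mfderivWithin_univ] at this
  exact this

theorem chartDSymm_comp_chartD {x₀ x : M} (hx : x ∈ (chartAt E x₀).source) :
    (chartDSymm x₀ x).comp (chartD x₀ x) = ContinuousLinearMap.id ℝ E := by
  have := mfderivWithin_extChartAt_symm_comp_mfderiv_extChartAt' (I := 𝓘(ℝ, E)) (x := x₀) (y := x)
    (by simpa using hx)
  rw [modelWithCornersSelf_coe, range_id, mfderivWithin_univ] at this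
  exact this

theorem chartD_chartDSymm {x₀ x : M} (hx : x ∈ (chartAt E x₀).source) (v : E) :
    chartD x₀ x (chartDSymm x₀ x v) = v :=
  congrArg (fun T : E →L[ℝ] E => T v) (chartD_comp_chartDSymm hx)

theorem chartDSymm_chartD {x₀ x : M} (hx : x ∈ (chartAt E x₀).source) (v : E) :
    chartDSymm x₀ x (chartD x₀ x v) = v :=
  congrArg (fun T : E →L[ℝ] E => T v) (chartDSymm_comp_chartD hx)

/-- The differential of a chart, as an isomorphism. -/
def chartDEquiv {x₀ x : M} (hx : x ∈ (chartAt E x₀).source) : E ≃L[ℝ] E :=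
  ContinuousLinearEquiv.equivOfInverse (chartD x₀ x) (chartDSymm x₀ x)
    (chartDSymm_chartD hx) (chartD_chartDSymm hx)

/-- The chart of `J¹(M, M)` given by charts of `M` around `x₀` and `y₀`. -/
def jetChart (x₀ y₀ : M) : PartialEquiv (J1 E M) ((E × E) × (E →L[ℝ] E)) :=
  extChartAt (J1model E) (mk1 x₀ y₀ 0)

theorem jetChart_eq (x₀ y₀ : M) : (jetChart x₀ y₀ : PartialEquiv (J1 E M) _) =
    (trivializationAt (E →L[ℝ] E) (fun p : M × M => SourceBundle 𝓘(ℝ, E) M 𝓘(ℝ, E) M p →L[ℝ]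
      TargetBundle 𝓘(ℝ, E) M 𝓘(ℝ, E) M p) (x₀, y₀)).toPartialEquiv ≫
        (extChartAt (𝓘(ℝ, E).prod 𝓘(ℝ, E)) (x₀, y₀)).prod (PartialEquiv.refl _) := by
  exact FiberBundle.extChartAt (𝕜 := ℝ) (F := E →L[ℝ] E)
    (E := (fun p : M × M => SourceBundle 𝓘(ℝ, E) M 𝓘(ℝ, E) M p →L[ℝ]
      TargetBundle 𝓘(ℝ, E) M 𝓘(ℝ, E) M p))
    (IB := 𝓘(ℝ, E).prod 𝓘(ℝ, E)) (TotalSpace.mk (x₀, y₀) 0)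

theorem mem_jetChart_source {x₀ y₀ : M} {ξ : J1 E M} : ξ ∈ (jetChart x₀ y₀).source ↔
    ξ.src ∈ (chartAt E x₀).source ∧ ξ.tgt ∈ (chartAt E y₀).source := by
  have key : (ξ.src, ξ.tgt) ∈ (extChartAt (𝓘(ℝ, E).prod 𝓘(ℝ, E)) (x₀, y₀)).source ↔
      ξ.src ∈ (chartAt E x₀).source ∧ ξ.tgt ∈ (chartAt E y₀).source := by
    rw [extChartAt_source]; rfl
  rw [jetChart_eq, PartialEquiv.trans_source, ← key]
  exact ⟨fun h => h.2.1, fun h => ⟨key.1 h, h, mem_univ _⟩⟩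

theorem jetChart_mk1 {x₀ y₀ x y : M} {φ : E →L[ℝ] E} (h1 : x ∈ (chartAt E x₀).source)
    (h2 : y ∈ (chartAt E y₀).source) :
    jetChart x₀ y₀ (mk1 x y φ) = ((extChartAt 𝓘(ℝ, E) x₀ x, extChartAt 𝓘(ℝ, E) y₀ y),
      (chartD y₀ y).comp (φ.comp (chartDSymm x₀ x))) := by
  have h3 := inCoordinates_oneJet 𝓘(ℝ, E) 𝓘(ℝ, E) h1 h2 φ
  rw [modelWithCornersSelf_coe, range_id, mfderivWithin_univ] at h3
  rw [jetChart_eq]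
  exact Prod.ext rfl h3

theorem jetChart_apply {x₀ y₀ : M} {ξ : J1 E M} (h : ξ ∈ (jetChart x₀ y₀).source) :
    jetChart x₀ y₀ ξ = ((extChartAt 𝓘(ℝ, E) x₀ ξ.src, extChartAt 𝓘(ℝ, E) y₀ ξ.tgt),
      (chartD y₀ ξ.tgt).comp (ξ.endo.comp (chartDSymm x₀ ξ.src))) :=
  jetChart_mk1 (mem_jetChart_source.1 h).1 (mem_jetChart_source.1 h).2

/-- The chart `jetChart x₀ y₀` takes all values whose base points lie in the targets of the charts
around `x₀` and `y₀`, whatever the linear part is. -/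
theorem jetChart_symm_aux {x₀ y₀ : M} {q : (E × E) × (E →L[ℝ] E)}
    (h1 : q.1.1 ∈ (extChartAt 𝓘(ℝ, E) x₀).target) (h2 : q.1.2 ∈ (extChartAt 𝓘(ℝ, E) y₀).target) :
    ∃ φ, mk1 ((extChartAt 𝓘(ℝ, E) x₀).symm q.1.1) ((extChartAt 𝓘(ℝ, E) y₀).symm q.1.2) φ ∈
      (jetChart x₀ y₀).source ∧ jetChart x₀ y₀ (mk1 ((extChartAt 𝓘(ℝ, E) x₀).symm q.1.1)
        ((extChartAt 𝓘(ℝ, E) y₀).symm q.1.2) φ) = q := by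
  set x := (extChartAt 𝓘(ℝ, E) x₀).symm q.1.1
  set y := (extChartAt 𝓘(ℝ, E) y₀).symm q.1.2
  have hx : x ∈ (chartAt E x₀).source := by
    have := (extChartAt 𝓘(ℝ, E) x₀).map_target h1
    rwa [extChartAt_source] at this
  have hy : y ∈ (chartAt E y₀).source := by
    have := (extChartAt 𝓘(ℝ, E) y₀).map_target h2
    rwa [extChartAt_source] at this
  refine ⟨(chartDSymm y₀ y).comp (q.2.comp (chartD x₀ x)), mem_jetChart_source.2 ⟨hx, hy⟩, ?_⟩
  rw [jetChart_mk1 hx hy]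
  refine Prod.ext (Prod.ext ((extChartAt 𝓘(ℝ, E) x₀).right_inv h1)
    ((extChartAt 𝓘(ℝ, E) y₀).right_inv h2)) ?_
  ext v
  simp [chartD_chartDSymm hx, chartD_chartDSymm hy]

theorem mem_jetChart_target {x₀ y₀ : M} {q : (E × E) × (E →L[ℝ] E)} :
    q ∈ (jetChart x₀ y₀ : PartialEquiv (J1 E M) _).target ↔
      q.1.1 ∈ (extChartAt 𝓘(ℝ, E) x₀).target ∧ q.1.2 ∈ (extChartAt 𝓘(ℝ, E) y₀).target := by
  constructor
  · intro h
    have h1 := (jetChart x₀ y₀).map_target h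
    rw [← (jetChart x₀ y₀).right_inv h, jetChart_apply h1]
    rw [mem_jetChart_source, ← extChartAt_source 𝓘(ℝ, E), ← extChartAt_source 𝓘(ℝ, E)] at h1
    exact ⟨PartialEquiv.map_source _ h1.1, PartialEquiv.map_source _ h1.2⟩
  · rintro ⟨h1, h2⟩
    obtain ⟨φ, h3, h4⟩ := jetChart_symm_aux h1 h2
    rw [← h4]
    exact PartialEquiv.map_source _ h3

theorem jetChart_symm_src {x₀ y₀ : M} {q : (E × E) × (E →L[ℝ] E)}
    (h : q ∈ (jetChart x₀ y₀ : PartialEquiv (J1 E M) _).target) :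
    ((jetChart x₀ y₀).symm q).src = (extChartAt 𝓘(ℝ, E) x₀).symm q.1.1 := by
  obtain ⟨φ, h3, h4⟩ := jetChart_symm_aux (mem_jetChart_target.1 h).1 (mem_jetChart_target.1 h).2
  have h5 := (jetChart x₀ y₀).left_inv h3
  rw [h4] at h5
  rw [h5, mk1_src]

theorem jetChart_symm_tgt {x₀ y₀ : M} {q : (E × E) × (E →L[ℝ] E)}
    (h : q ∈ (jetChart x₀ y₀ : PartialEquiv (J1 E M) _).target) :
    ((jetChart x₀ y₀).symm q).tgt = (extChartAt 𝓘(ℝ, E) y₀).symm q.1.2 := by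
  obtain ⟨φ, h3, h4⟩ := jetChart_symm_aux (mem_jetChart_target.1 h).1 (mem_jetChart_target.1 h).2
  have h5 := (jetChart x₀ y₀).left_inv h3
  rw [h4] at h5
  rw [h5, mk1_tgt]

theorem isOpen_jetChart_source (x₀ y₀ : M) :
    IsOpen (jetChart x₀ y₀ : PartialEquiv (J1 E M) _).source :=
  isOpen_extChartAt_source (I := J1model E) (mk1 x₀ y₀ (0 : E →L[ℝ] E))

theorem contMDiffOn_jetChart (x₀ y₀ : M) : ContMDiffOn (J1model E) 𝓘(ℝ, (E × E) × (E →L[ℝ] E)) ∞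
    (jetChart x₀ y₀) (jetChart x₀ y₀ : PartialEquiv (J1 E M) _).source := by
  have := contMDiffOn_extChartAt (I := J1model E) (n := ∞) (x := mk1 x₀ y₀ (0 : E →L[ℝ] E))
  rwa [← extChartAt_source (J1model E)] at this

theorem contMDiffOn_jetChart_symm (x₀ y₀ : M) :
    ContMDiffOn 𝓘(ℝ, (E × E) × (E →L[ℝ] E)) (J1model E) ∞
    (jetChart x₀ y₀).symm (jetChart x₀ y₀ : PartialEquiv (J1 E M) _).target :=
  contMDiffOn_extChartAt_symm (I := J1model E) (n := ∞) (mk1 x₀ y₀ (0 : E →L[ℝ] E))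

/-! ### The linear part of a `(1,1)`-jet in coordinates -/

/-- The differential at `ξ` of the chart of `J¹(M, M)` around `(x₀, y₀)`. -/
def jetChartD (x₀ y₀ : M) (ξ : J1 E M) : ((E × E) × (E →L[ℝ] E)) →L[ℝ] (E × E) × (E →L[ℝ] E) :=
  mfderiv (J1model E) 𝓘(ℝ, (E × E) × (E →L[ℝ] E)) (jetChart x₀ y₀) ξ

/-- The inverse of the differential of the chart of `J¹(M, M)` around `(x₀, y₀)`. -/
def jetChartDSymm (x₀ y₀ : M) (ξ : J1 E M) :
    ((E × E) × (E →L[ℝ] E)) →L[ℝ] (E × E) × (E →L[ℝ] E) :=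
  mfderiv 𝓘(ℝ, (E × E) × (E →L[ℝ] E)) (J1model E) (jetChart x₀ y₀).symm (jetChart x₀ y₀ ξ)

theorem range_J1model : range (J1model E) = univ := by
  simp

theorem jetChartD_comp_jetChartDSymm {x₀ y₀ : M} {ξ : J1 E M} (h : ξ ∈ (jetChart x₀ y₀).source) :
    (jetChartD x₀ y₀ ξ).comp (jetChartDSymm x₀ y₀ ξ) = ContinuousLinearMap.id ℝ _ := by
  have := mfderiv_extChartAt_comp_mfderivWithin_extChartAt_symm' (I := J1model E)
    (x := mk1 x₀ y₀ (0 : E →L[ℝ] E)) (y := ξ) h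
  rw [range_J1model, mfderivWithin_univ] at this
  exact this

theorem jetChartDSymm_comp_jetChartD {x₀ y₀ : M} {ξ : J1 E M} (h : ξ ∈ (jetChart x₀ y₀).source) :
    (jetChartDSymm x₀ y₀ ξ).comp (jetChartD x₀ y₀ ξ) = ContinuousLinearMap.id ℝ _ := by
  have := mfderivWithin_extChartAt_symm_comp_mfderiv_extChartAt' (I := J1model E)
    (x := mk1 x₀ y₀ (0 : E →L[ℝ] E)) (y := ξ) h
  rw [range_J1model, mfderivWithin_univ] at this
  exact this

/-- The linear part of a `(1,1)`-jet `A`, read in the charts around `x₀` and `y₀`. -/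
def coordD (x₀ y₀ : M) (A : J11 E M) : E →L[ℝ] (E × E) × (E →L[ℝ] E) :=
  (jetChartD x₀ y₀ A.tgt).comp ((jetLin A).comp (chartDSymm x₀ A.src))

/-- A `(1,1)`-jet is determined by its source, its target and its linear part in coordinates. -/
theorem J11_ext {x₀ y₀ : M} {A B : J11 E M} (h1 : A.src = B.src) (h2 : A.tgt = B.tgt)
    (hx : A.src ∈ (chartAt E x₀).source) (hy : A.tgt ∈ (jetChart x₀ y₀).source)
    (h : coordD x₀ y₀ A = coordD x₀ y₀ B) : A = B := by
  rw [coordD, coordD, ← h1, ← h2] at h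
  rw [← mk2_eta A, ← mk2_eta B, ← h1, ← h2]
  congr 1
  have h3 := congrArg (fun T => (jetChartDSymm x₀ y₀ A.tgt).comp (T.comp (chartD x₀ A.src))) h
  ext1 v
  have h4 := congrArg (fun T : E →L[ℝ] (E × E) × (E →L[ℝ] E) => T v) h3
  have h5 := fun w => congrArg (fun T : _ →L[ℝ] (E × E) × (E →L[ℝ] E) => T w)
    (jetChartDSymm_comp_jetChartD hy)
  simp only [ContinuousLinearMap.comp_apply, chartDSymm_chartD hx] at h4
  simp only [ContinuousLinearMap.comp_apply, ContinuousLinearMap.id_apply] at h5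
  rwa [h5, h5] at h4

theorem jetAt_src (f : M → J1 E M) (x : M) : (jetAt 𝓘(ℝ, E) (J1model E) f x).src = x := rfl
theorem jetAt_tgt (f : M → J1 E M) (x : M) : (jetAt 𝓘(ℝ, E) (J1model E) f x).tgt = f x := rfl

theorem hasMFDerivAt_chart {x₀ x : M} (hx : x ∈ (chartAt E x₀).source) :
    HasMFDerivAt 𝓘(ℝ, E) 𝓘(ℝ, E) (extChartAt 𝓘(ℝ, E) x₀) x
      (chartD x₀ x : E →L[ℝ] E) :=
  (mdifferentiableAt_extChartAt hx).hasMFDerivAt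

theorem hasMFDerivAt_chart_symm {x₀ x : M} (hx : x ∈ (chartAt E x₀).source) :
    HasMFDerivAt 𝓘(ℝ, E) 𝓘(ℝ, E) (extChartAt 𝓘(ℝ, E) x₀).symm (extChartAt 𝓘(ℝ, E) x₀ x)
      (chartDSymm x₀ x : E →L[ℝ] E) := by
  have h : extChartAt 𝓘(ℝ, E) x₀ x ∈ (extChartAt 𝓘(ℝ, E) x₀).target :=
    (extChartAt 𝓘(ℝ, E) x₀).map_source (by rwa [extChartAt_source])
  have := mdifferentiableWithinAt_extChartAt_symm (I := 𝓘(ℝ, E)) h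
  rw [modelWithCornersSelf_coe, range_id, mdifferentiableWithinAt_univ] at this
  exact this.hasMFDerivAt

theorem hasMFDerivAt_jetChart {x₀ y₀ : M} {ξ : J1 E M} (h : ξ ∈ (jetChart x₀ y₀).source) :
    HasMFDerivAt (J1model E) 𝓘(ℝ, (E × E) × (E →L[ℝ] E)) (jetChart x₀ y₀) ξ
      (jetChartD x₀ y₀ ξ) :=
  (((contMDiffOn_jetChart x₀ y₀).contMDiffAt
    ((isOpen_jetChart_source x₀ y₀).mem_nhds h)).mdifferentiableAt (by simp)).hasMFDerivAt

theorem isOpen_jetChart_target (x₀ y₀ : M) :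
    IsOpen (jetChart x₀ y₀ : PartialEquiv (J1 E M) _).target := by
  have : (jetChart x₀ y₀ : PartialEquiv (J1 E M) _).target =
      ((extChartAt 𝓘(ℝ, E) x₀).target ×ˢ (extChartAt 𝓘(ℝ, E) y₀).target) ×ˢ univ := by
    ext q; simp [mem_jetChart_target]
  rw [this]
  exact ((isOpen_extChartAt_target x₀).prod (isOpen_extChartAt_target y₀)).prod isOpen_univ

theorem hasMFDerivAt_jetChart_symm {x₀ y₀ : M} {ξ : J1 E M} (h : ξ ∈ (jetChart x₀ y₀).source) :
    HasMFDerivAt 𝓘(ℝ, (E × E) × (E →L[ℝ] E)) (J1model E) (jetChart x₀ y₀).symm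
      (jetChart x₀ y₀ ξ) (jetChartDSymm x₀ y₀ ξ) :=
  (((contMDiffOn_jetChart_symm x₀ y₀).contMDiffAt
    ((isOpen_jetChart_target x₀ y₀).mem_nhds
      ((jetChart x₀ y₀).map_source h))).mdifferentiableAt (by simp)).hasMFDerivAt

/-- In coordinates, the linear part of `j¹_x f` is the derivative of `f`. -/
theorem hasFDerivAt_coordD {x₀ y₀ x : M} {f : M → J1 E M} (hx : x ∈ (chartAt E x₀).source)
    (hy : f x ∈ (jetChart x₀ y₀).source) (hf : MDifferentiableAt 𝓘(ℝ, E) (J1model E) f x) :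
    HasFDerivAt (fun u => jetChart x₀ y₀ (f ((extChartAt 𝓘(ℝ, E) x₀).symm u)))
      (coordD x₀ y₀ (jetAt 𝓘(ℝ, E) (J1model E) f x)) (extChartAt 𝓘(ℝ, E) x₀ x) := by
  have hl : (extChartAt 𝓘(ℝ, E) x₀).symm (extChartAt 𝓘(ℝ, E) x₀ x) = x :=
    (extChartAt 𝓘(ℝ, E) x₀).left_inv (by rwa [extChartAt_source])
  have h1 := hasMFDerivAt_chart_symm hx
  have h2 := hf.hasMFDerivAt
  have h3 := hasMFDerivAt_jetChart hy
  have h4 := HasMFDerivAt.comp x h3 h2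
  rw [← hl] at h4
  have h5 := HasMFDerivAt.comp _ h4 h1
  rw [hasMFDerivAt_iff_hasFDerivAt] at h5
  convert! h5 using 1
  rw [hl]
  rfl

/-- The linear part of `j¹_x f` can be computed from any expression `F` of `f` in coordinates. -/
theorem coordD_jetAt {x₀ y₀ x : M} {f : M → J1 E M} (hx : x ∈ (chartAt E x₀).source)
    (hy : f x ∈ (jetChart x₀ y₀).source) {F : E → (E × E) × (E →L[ℝ] E)}
    {F' : E →L[ℝ] (E × E) × (E →L[ℝ] E)} (hF : HasFDerivAt F F' (extChartAt 𝓘(ℝ, E) x₀ x))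
    (h : ∀ᶠ x' in 𝓝 x, f x' ∈ (jetChart x₀ y₀).source ∧
      jetChart x₀ y₀ (f x') = F (extChartAt 𝓘(ℝ, E) x₀ x')) :
    coordD x₀ y₀ (jetAt 𝓘(ℝ, E) (J1model E) f x) = F' := by
  have h0 := h.self_of_nhds.2
  have h1 := HasMFDerivAt.comp x hF.hasMFDerivAt (hasMFDerivAt_chart hx)
  have h2 := hasMFDerivAt_jetChart_symm hy
  rw [h0] at h2
  have h3 := HasMFDerivAt.comp x h2 h1
  have h4 : f =ᶠ[𝓝 x] (jetChart x₀ y₀).symm ∘ F ∘ (extChartAt 𝓘(ℝ, E) x₀) := by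
    filter_upwards [h] with x' hx'
    simp only [Function.comp_apply, ← hx'.2]
    exact ((jetChart x₀ y₀).left_inv hx'.1).symm
  have h5 := (h3.congr_of_eventuallyEq h4).mfderiv
  have h6 : jetLin (jetAt 𝓘(ℝ, E) (J1model E) f x) =
    (jetChartDSymm x₀ y₀ (f x)).comp (F'.comp (chartD x₀ x)) := h5
  rw [coordD, jetAt_src, jetAt_tgt, h6]
  ext1 v
  have h7 := fun w => congrArg (fun T : _ →L[ℝ] (E × E) × (E →L[ℝ] E) => T w)
    (jetChartD_comp_jetChartDSymm hy)
  simp only [ContinuousLinearMap.comp_apply, ContinuousLinearMap.id_apply] at h7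
  simp only [ContinuousLinearMap.comp_apply, chartD_chartDSymm hx, h7]

/-- A family of `(1,1)`-jets is smooth if its source, its target, and its linear part in charts
are smooth. -/
theorem contMDiffAt_J11_iff {F : Type*} [NormedAddCommGroup F] [NormedSpace ℝ F]
    {H : Type*} [TopologicalSpace H] {I : ModelWithCorners ℝ F H}
    {N : Type*} [TopologicalSpace N] [ChartedSpace H N] {f : N → J11 E M} {n : N}
    (hn : (f n).tgt.src = (f n).src) :
    ContMDiffAt I (J11model E) ∞ f n ↔
      ContMDiffAt I 𝓘(ℝ, E) ∞ (fun m => (f m).src) n ∧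
      ContMDiffAt I (J1model E) ∞ (fun m => (f m).tgt) n ∧
      ContMDiffAt I 𝓘(ℝ, E →L[ℝ] (E × E) × (E →L[ℝ] E)) ∞
        (fun m => coordD (f n).src (f n).tgt.tgt (f m)) n := by
  have h0 : ContMDiffAt I (J11model E) ∞ f n ↔
      ContMDiffAt I (𝓘(ℝ, E).prod (J1model E)) ∞ (fun m => ((f m).src, (f m).tgt)) n ∧
      ContMDiffAt I 𝓘(ℝ, E →L[ℝ] (E × E) × (E →L[ℝ] E)) ∞
        (fun m => ContinuousLinearMap.inCoordinates E
          (SourceBundle 𝓘(ℝ, E) M (J1model E) (J1 E M)) ((E × E) × (E →L[ℝ] E))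
          (TargetBundle 𝓘(ℝ, E) M (J1model E) (J1 E M)) ((f n).src, (f n).tgt)
          ((f m).src, (f m).tgt) ((f n).src, (f n).tgt) ((f m).src, (f m).tgt)
          (jetLin (f m) : E →L[ℝ] (E × E) × (E →L[ℝ] E))) n :=
    contMDiffAt_hom_bundle f
  rw [h0, contMDiffAt_prod_iff, and_assoc]
  refine and_congr_right fun h1 => and_congr_right fun h2 => ?_
  have e1 : ∀ᶠ m in 𝓝 n, (f m).src ∈ (chartAt E (f n).src).source :=
    h1.continuousAt ((chartAt E (f n).src).open_source.mem_nhds (mem_chart_source E (f n).src))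
  have e2 : ∀ᶠ m in 𝓝 n, (f m).tgt ∈ (chartAt (ModelProd (ModelProd E E) (E →L[ℝ] E))
      (f n).tgt).source :=
    h2.continuousAt ((chartAt _ (f n).tgt).open_source.mem_nhds (mem_chart_source _ (f n).tgt))
  have e3 : (extChartAt (J1model E) (f n).tgt) = jetChart (f n).tgt.src (f n).tgt.tgt := rfl
  refine Filter.EventuallyEq.contMDiffAt_iff ?_
  filter_upwards [e1, e2] with m hm1 hm2
  rw [inCoordinates_oneJet 𝓘(ℝ, E) (J1model E) hm1 hm2, e3, hn, modelWithCornersSelf_coe, range_id,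
    mfderivWithin_univ]
  rfl

/-! ### Bisections and their jets in coordinates -/

/-- The linear part of a 1-jet, read in the charts around `x₀` and `y₀`. -/
def coordLin (x₀ y₀ : M) (ξ : J1 E M) : E →L[ℝ] E :=
  (chartD y₀ ξ.tgt).comp (ξ.endo.comp (chartDSymm x₀ ξ.src))

/-- The derivative of the base map of a `(1,1)`-jet, read in the charts around `x₀` and `y₀`. -/
def coordBase (x₀ y₀ : M) (A : J11 E M) : E →L[ℝ] E :=
  ((ContinuousLinearMap.snd ℝ E E).comp (ContinuousLinearMap.fst ℝ (E × E) (E →L[ℝ] E))).comp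
    (coordD x₀ y₀ A)

/-- The derivative of the linear part of a `(1,1)`-jet, read in the charts around `x₀` and `y₀`. -/
def coordHess (x₀ y₀ : M) (A : J11 E M) : E →L[ℝ] E →L[ℝ] E :=
  (ContinuousLinearMap.snd ℝ (E × E) (E →L[ℝ] E)).comp (coordD x₀ y₀ A)

/-- The linear part of a bisection, regarded as an endomorphism of the model space. -/
def LocalBisection.endo (b : LocalBisection E M) (x : M) : E →L[ℝ] E := b.lin x

theorem LocalBisection.toJ1_eq (b : LocalBisection E M) (x : M) :
    b.toJ1 x = mk1 x (b.base x) (b.endo x) := rfl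

theorem LocalBisection.contMDiffAt_toJ1 (b : LocalBisection E M) {x : M}
    (hx : x ∈ b.base.source) : ContMDiffAt 𝓘(ℝ, E) (J1model E) ∞ b.toJ1 x :=
  b.smooth.contMDiffAt (b.base.open_source.mem_nhds hx)

theorem LocalBisection.contMDiffAt_base (b : LocalBisection E M) {x : M}
    (hx : x ∈ b.base.source) : ContMDiffAt 𝓘(ℝ, E) 𝓘(ℝ, E) ∞ b.base x :=
  b.base.contMDiffOn.contMDiffAt (b.base.open_source.mem_nhds hx)

theorem Represents.tgt_eq {b : LocalBisection E M} {A : J11 E M} (h : Represents b A) :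
    A.tgt = mk1 A.src (b.base A.src) (b.endo A.src) := by
  conv_lhs => rw [← h.2]
  rfl

theorem B11.tgt_src {A : J11 E M} (h : A ∈ B11 E M) : A.tgt.src = A.src := by
  obtain ⟨b, hb⟩ := h
  rw [hb.tgt_eq]; rfl

theorem Represents.base_eq {b : LocalBisection E M} {A : J11 E M} (h : Represents b A) :
    b.base A.src = A.tgt.tgt := by
  rw [h.tgt_eq]; rfl

theorem Represents.lin_eq {b : LocalBisection E M} {A : J11 E M} (h : Represents b A) :
    b.endo A.src = A.tgt.endo := by
  rw [h.tgt_eq]; rfl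

theorem left_inv_chart {x₀ x : M} (hx : x ∈ (chartAt E x₀).source) :
    (extChartAt 𝓘(ℝ, E) x₀).symm (extChartAt 𝓘(ℝ, E) x₀ x) = x :=
  (extChartAt 𝓘(ℝ, E) x₀).left_inv (by rwa [extChartAt_source])

theorem chart_mem_target {x₀ x : M} (hx : x ∈ (chartAt E x₀).source) :
    extChartAt 𝓘(ℝ, E) x₀ x ∈ (extChartAt 𝓘(ℝ, E) x₀).target :=
  (extChartAt 𝓘(ℝ, E) x₀).map_source (by rwa [extChartAt_source])

theorem continuousAt_chart_symm {x₀ x : M} (hx : x ∈ (chartAt E x₀).source) :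
    Filter.Tendsto (extChartAt 𝓘(ℝ, E) x₀).symm (𝓝 (extChartAt 𝓘(ℝ, E) x₀ x)) (𝓝 x) := by
  have := (hasMFDerivAt_chart_symm hx).continuousAt
  rwa [ContinuousAt, left_inv_chart hx] at this

theorem Represents.mem_jetChart_source {b : LocalBisection E M} {A : J11 E M}
    (h : Represents b A) {x₀ y₀ : M} (hx : A.src ∈ (chartAt E x₀).source)
    (hy : A.tgt.tgt ∈ (chartAt E y₀).source) :
    A.tgt ∈ (jetChart x₀ y₀).source := by
  refine JetGroupoid.mem_jetChart_source.2 ⟨?_, hy⟩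
  rwa [B11.tgt_src ⟨b, h⟩]

theorem LocalBisection.eventually_mem (b : LocalBisection E M) {x x₀ y₀ : M}
    (hb : x ∈ b.base.source) (hx : x ∈ (chartAt E x₀).source)
    (hy : b.base x ∈ (chartAt E y₀).source) :
    ∀ᶠ x' in 𝓝 x, x' ∈ b.base.source ∧ x' ∈ (chartAt E x₀).source ∧
      b.base x' ∈ (chartAt E y₀).source := by
  filter_upwards [b.base.open_source.mem_nhds hb, (chartAt E x₀).open_source.mem_nhds hx,
    (b.contMDiffAt_base hb).continuousAt ((chartAt E y₀).open_source.mem_nhds hy)] with x' h1 h2 h3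
  exact ⟨h1, h2, h3⟩

section Coord

variable {b : LocalBisection E M} {A : J11 E M} {x₀ y₀ : M}

theorem Represents.hasFDerivAt (h : Represents b A) (hx : A.src ∈ (chartAt E x₀).source)
    (hy : A.tgt.tgt ∈ (chartAt E y₀).source) :
    HasFDerivAt (fun u => jetChart x₀ y₀ (b.toJ1 ((extChartAt 𝓘(ℝ, E) x₀).symm u)))
      (coordD x₀ y₀ A) (extChartAt 𝓘(ℝ, E) x₀ A.src) := by
  have h1 := hasFDerivAt_coordD (f := b.toJ1) hx (y₀ := y₀)
    (by have := h.mem_jetChart_source hx hy; rwa [h.tgt_eq] at this)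
    ((b.contMDiffAt_toJ1 h.1).mdifferentiableAt (by simp))
  have h2 : jetAt 𝓘(ℝ, E) (J1model E) b.toJ1 A.src = A := h.2
  rwa [h2] at h1

/-- A bisection in coordinates. -/
theorem Represents.eventually_coord (h : Represents b A) (hx : A.src ∈ (chartAt E x₀).source)
    (hy : A.tgt.tgt ∈ (chartAt E y₀).source) :
    ∀ᶠ u in 𝓝 (extChartAt 𝓘(ℝ, E) x₀ A.src),
      jetChart x₀ y₀ (b.toJ1 ((extChartAt 𝓘(ℝ, E) x₀).symm u)) =
        ((u, extChartAt 𝓘(ℝ, E) y₀ (b.base ((extChartAt 𝓘(ℝ, E) x₀).symm u))),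
          coordLin x₀ y₀ (b.toJ1 ((extChartAt 𝓘(ℝ, E) x₀).symm u))) := by
  have h1 := continuousAt_chart_symm hx (b.eventually_mem h.1 hx (y₀ := y₀)
    (by rwa [h.base_eq]))
  filter_upwards [h1, (isOpen_extChartAt_target x₀).mem_nhds (chart_mem_target hx)] with u hu hu'
  rw [b.toJ1_eq, jetChart_mk1 hu.2.1 hu.2.2, PartialEquiv.right_inv _ hu']
  rfl

theorem Represents.coordD_fst_fst (h : Represents b A) (hx : A.src ∈ (chartAt E x₀).source)
    (hy : A.tgt.tgt ∈ (chartAt E y₀).source) (v : E) : (coordD x₀ y₀ A v).1.1 = v := by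
  have h1 := ((h.hasFDerivAt hx hy).congr_of_eventuallyEq
    (Filter.EventuallyEq.symm (h.eventually_coord hx hy))).fst.fst
  have h2 := congrArg (fun T : E →L[ℝ] E => T v) (h1.unique (hasFDerivAt_id _))
  exact h2

theorem Represents.hasFDerivAt_base (h : Represents b A) (hx : A.src ∈ (chartAt E x₀).source)
    (hy : A.tgt.tgt ∈ (chartAt E y₀).source) :
    HasFDerivAt (fun u => extChartAt 𝓘(ℝ, E) y₀ (b.base ((extChartAt 𝓘(ℝ, E) x₀).symm u)))
      (coordBase x₀ y₀ A) (extChartAt 𝓘(ℝ, E) x₀ A.src) :=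
  ((h.hasFDerivAt hx hy).congr_of_eventuallyEq
    (Filter.EventuallyEq.symm (h.eventually_coord hx hy))).fst.snd

theorem Represents.hasFDerivAt_lin (h : Represents b A) (hx : A.src ∈ (chartAt E x₀).source)
    (hy : A.tgt.tgt ∈ (chartAt E y₀).source) :
    HasFDerivAt (fun u => coordLin x₀ y₀ (b.toJ1 ((extChartAt 𝓘(ℝ, E) x₀).symm u)))
      (coordHess x₀ y₀ A) (extChartAt 𝓘(ℝ, E) x₀ A.src) :=
  ((h.hasFDerivAt hx hy).congr_of_eventuallyEq
    (Filter.EventuallyEq.symm (h.eventually_coord hx hy))).snd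

theorem B11.coordD_eq (h : A ∈ B11 E M) (hx : A.src ∈ (chartAt E x₀).source)
    (hy : A.tgt.tgt ∈ (chartAt E y₀).source) :
    coordD x₀ y₀ A =
      ((ContinuousLinearMap.id ℝ E).prod (coordBase x₀ y₀ A)).prod (coordHess x₀ y₀ A) := by
  obtain ⟨b, hb⟩ := h
  ext1 v
  exact Prod.ext (Prod.ext (hb.coordD_fst_fst hx hy v) rfl) rfl

/-- The differential of the target map of `J¹(M, M)` in coordinates. -/
theorem chartD_comp_mfderiv_tgt {ξ : J1 E M} (h : ξ ∈ (jetChart x₀ y₀).source) :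
    (chartD y₀ ξ.tgt : E →L[ℝ] E).comp
      (mfderiv (J1model E) 𝓘(ℝ, E) (fun ξ : J1 E M => ξ.tgt) ξ :
        (E × E) × (E →L[ℝ] E) →L[ℝ] E) =
    ((ContinuousLinearMap.snd ℝ E E).comp (ContinuousLinearMap.fst ℝ (E × E) (E →L[ℝ] E))).comp
      (jetChartD x₀ y₀ ξ) := by
  have h1 := HasMFDerivAt.comp ξ (hasMFDerivAt_chart (JetGroupoid.mem_jetChart_source.1 h).2)
    ((contMDiff_tgt ξ).mdifferentiableAt (by simp)).hasMFDerivAt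
  have h2 := HasMFDerivAt.comp ξ (((ContinuousLinearMap.snd ℝ E E).comp
    (ContinuousLinearMap.fst ℝ (E × E) (E →L[ℝ] E))).hasFDerivAt.hasMFDerivAt)
    (hasMFDerivAt_jetChart h)
  refine hasMFDerivAt_unique (h1.congr_of_eventuallyEq ?_) h2
  filter_upwards [(isOpen_jetChart_source x₀ y₀).mem_nhds h] with η hη
  simp [jetChart_apply hη]

/-- In coordinates, `p = p_*` says that the derivative of the base map is the linear part. -/
theorem p_eq_pStar_iff (h : A.tgt.src = A.src) (hx : A.src ∈ (chartAt E x₀).source)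
    (hy : A.tgt.tgt ∈ (chartAt E y₀).source) :
    p A = pStar A ↔ coordBase x₀ y₀ A = coordLin x₀ y₀ A.tgt := by
  have hs : A.tgt ∈ (jetChart x₀ y₀).source :=
    JetGroupoid.mem_jetChart_source.2 ⟨by rwa [h], hy⟩
  set T : (E × E) × (E →L[ℝ] E) →L[ℝ] E :=
    mfderiv (J1model E) 𝓘(ℝ, E) (fun ξ : J1 E M => ξ.tgt) A.tgt with hT
  have e1 : pStar A = mk1 A.tgt.src A.tgt.tgt (T.comp (jetLin A)) := by rw [h]; rfl
  have e2 : p A = mk1 A.tgt.src A.tgt.tgt A.tgt.endo := rfl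
  have e3 : coordBase x₀ y₀ A =
      (chartD y₀ A.tgt.tgt).comp ((T.comp (jetLin A)).comp (chartDSymm x₀ A.src)) := by
    have := chartD_comp_mfderiv_tgt hs
    rw [coordBase, coordD, ← ContinuousLinearMap.comp_assoc, ← this]
    rfl
  have e4 : p A = pStar A ↔ A.tgt.endo = T.comp (jetLin A) := by
    rw [e1, e2]
    exact ⟨fun h => congrArg OneJet.endo h, fun h => by rw [h]⟩
  rw [e4, e3, coordLin, h]
  constructor
  · rintro h; rw [h]
  · intro h1
    ext v
    have h2 := congrArg (fun S : E →L[ℝ] E => chartDSymm y₀ A.tgt.tgt (S (chartD x₀ A.src v))) h1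
    simp only [ContinuousLinearMap.comp_apply, chartDSymm_chartD hx, chartDSymm_chartD hy] at h2
    exact h2.symm

theorem SemiHolonomic.coordBase_eq (h : A ∈ SemiHolonomic E M)
    (hx : A.src ∈ (chartAt E x₀).source) (hy : A.tgt.tgt ∈ (chartAt E y₀).source) :
    coordBase x₀ y₀ A = coordLin x₀ y₀ A.tgt :=
  (p_eq_pStar_iff (B11.tgt_src h.1) hx hy).1 h.2

/-- A semi-holonomic `(1,1)`-jet is determined by its first order part and its Hessian. -/
theorem SemiHolonomic.ext {A' : J11 E M} (h : A ∈ SemiHolonomic E M)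
    (h' : A' ∈ SemiHolonomic E M) (ht : A.tgt = A'.tgt)
    (hx : A.src ∈ (chartAt E x₀).source) (hy : A.tgt.tgt ∈ (chartAt E y₀).source)
    (hh : coordHess x₀ y₀ A = coordHess x₀ y₀ A') : A = A' := by
  have hs : A.src = A'.src := by rw [← B11.tgt_src h.1, ← B11.tgt_src h'.1, ht]
  refine J11_ext hs ht hx (y₀ := y₀) (h.1.elim fun b hb => hb.mem_jetChart_source hx hy) ?_
  rw [B11.coordD_eq h.1 hx hy, B11.coordD_eq h'.1 (by rwa [← hs]) (by rwa [← ht]),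
    SemiHolonomic.coordBase_eq h hx hy,
    SemiHolonomic.coordBase_eq h' (by rwa [← hs]) (by rwa [← ht]), ht, hh]

end Coord

/-- The product of `(1,1)`-jets in coordinates: the product rule and the chain rule. -/
theorem coordD_mul {b₂ b₁ : LocalBisection E M} {A₂ A₁ : J11 E M} (h₂ : Represents b₂ A₂)
    (h₁ : Represents b₁ A₁) (h : A₂.src = b₁.base A₁.src) {x₀ y₀ z₀ : M}
    (hx : A₁.src ∈ (chartAt E x₀).source) (hy : A₂.src ∈ (chartAt E y₀).source)
    (hz : A₂.tgt.tgt ∈ (chartAt E z₀).source) :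
    coordD x₀ z₀ (jetAt 𝓘(ℝ, E) (J1model E) (b₂.mul b₁) A₁.src) =
      ((ContinuousLinearMap.id ℝ E).prod
        ((coordBase y₀ z₀ A₂).comp (coordBase x₀ y₀ A₁))).prod
      ((ContinuousLinearMap.compL ℝ E E E (coordLin y₀ z₀ A₂.tgt)).comp (coordHess x₀ y₀ A₁) +
        ((ContinuousLinearMap.compL ℝ E E E).flip (coordLin x₀ y₀ A₁.tgt)).comp
          ((coordHess y₀ z₀ A₂).comp (coordBase x₀ y₀ A₁))) := by
  have hy' : A₁.tgt.tgt ∈ (chartAt E y₀).source := by rwa [← h₁.base_eq, ← h]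
  have hm : ∀ x', b₂.mul b₁ x' = mk1 x' (b₂.base (b₁.base x'))
      ((b₂.endo (b₁.base x')).comp (b₁.endo x')) := fun x' => rfl
  have ev1 := b₁.eventually_mem h₁.1 hx (y₀ := y₀) (by rwa [← h])
  have ev2 := (b₁.contMDiffAt_base h₁.1).continuousAt
    (by rw [← h]; exact b₂.eventually_mem h₂.1 hy (y₀ := z₀) (by rwa [h₂.base_eq]))
  set β : E → E := fun u => extChartAt 𝓘(ℝ, E) y₀ (b₁.base ((extChartAt 𝓘(ℝ, E) x₀).symm u))
    with hβ
  have hp : β (extChartAt 𝓘(ℝ, E) x₀ A₁.src) = extChartAt 𝓘(ℝ, E) y₀ A₂.src := by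
    rw [hβ]
    simp only [left_inv_chart hx, h]
  have d1 : HasFDerivAt β _ _ := h₁.hasFDerivAt_base hx hy'
  have d2 := h₁.hasFDerivAt_lin hx hy'
  have d3 := h₂.hasFDerivAt_base hy hz
  have d4 := h₂.hasFDerivAt_lin hy hz
  rw [← hp] at d3 d4
  have d5 := d3.comp _ d1
  have d6 := (d4.comp _ d1).clm_comp d2
  have d7 := ((hasFDerivAt_id (𝕜 := ℝ) (extChartAt 𝓘(ℝ, E) x₀ A₁.src)).prodMk d5).prodMk d6
  have e1 : b₁.toJ1 ((extChartAt 𝓘(ℝ, E) x₀).symm (extChartAt 𝓘(ℝ, E) x₀ A₁.src)) = A₁.tgt := by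
    rw [left_inv_chart hx, h₁.tgt_eq]; rfl
  have e2 : b₂.toJ1 ((extChartAt 𝓘(ℝ, E) y₀).symm (extChartAt 𝓘(ℝ, E) y₀ A₂.src)) = A₂.tgt := by
    rw [left_inv_chart hy, h₂.tgt_eq]; rfl
  have d8 := coordD_jetAt (f := b₂.mul b₁) (y₀ := z₀) hx
    (JetGroupoid.mem_jetChart_source.2 ⟨hx, by
      rw [hm, mk1_tgt, ← h, h₂.base_eq]; exact hz⟩) d7 (by
    filter_upwards [ev1, ev2] with x' h1 h2
    have h2' : b₁.base x' ∈ b₂.base.source ∧ b₁.base x' ∈ (chartAt E y₀).source ∧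
      b₂.base (b₁.base x') ∈ (chartAt E z₀).source := h2
    refine ⟨JetGroupoid.mem_jetChart_source.2 ⟨h1.2.1, h2'.2.2⟩, ?_⟩
    rw [hm, jetChart_mk1 h1.2.1 h2'.2.2]
    simp only [hβ, id_eq, Function.comp_apply, left_inv_chart h1.2.1, left_inv_chart h1.2.2]
    refine Prod.ext rfl ?_
    ext v
    simp only [coordLin, LocalBisection.toJ1_eq, mk1_src, mk1_tgt, mk1_endo,
      ContinuousLinearMap.comp_apply, chartDSymm_chartD h1.2.2])
  rw [d8]
  simp only [Function.comp_apply, hp, e1, e2]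

/-! ### Bisections with prescribed expression in coordinates -/

/-- The chart of `M` around `x` as a partial diffeomorphism. -/
def chartDiffeo (x : M) : PartialDiffeomorph 𝓘(ℝ, E) 𝓘(ℝ, E) M E ∞ where
  toPartialEquiv := extChartAt 𝓘(ℝ, E) x
  open_source := isOpen_extChartAt_source x
  open_target := isOpen_extChartAt_target x
  contMDiffOn_toFun := by
    have := contMDiffOn_extChartAt (I := 𝓘(ℝ, E)) (n := ∞) (x := x)
    rwa [← extChartAt_source 𝓘(ℝ, E)] at this
  contMDiffOn_invFun := contMDiffOn_extChartAt_symm x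

/-- A partial diffeomorphism of a vector space from the inverse function theorem. -/
theorem exists_partialDiffeomorph [CompleteSpace E] {β : E → E} (hβ : ContDiff ℝ ∞ β) {u : E}
    (h : (fderiv ℝ β u).IsInvertible) : ∃ g : PartialDiffeomorph 𝓘(ℝ, E) 𝓘(ℝ, E) E E ∞,
      u ∈ g.source ∧ g.toFun = β := by
  obtain ⟨T, hT⟩ := h
  have h1 : HasFDerivAt β (T : E →L[ℝ] E) u := by
    rw [hT]; exact (hβ.differentiable (by simp) u).hasFDerivAt
  set O := hβ.contDiffAt.toOpenPartialHomeomorph β h1 (by simp) with hO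
  have hO' : ⇑O = β := rfl
  have hW : IsOpen {v : E | (fderiv ℝ β v).IsInvertible} := by
    exact (ContinuousLinearEquiv.isOpen (𝕜 := ℝ) (E := E) (F := E)).preimage
      (hβ.continuous_fderiv (by simp))
  -- smoothness of the inverse needs an invertible derivative at every point of the domain
  set O₁ := O.restrOpen _ hW with hO₁
  refine ⟨{ toPartialEquiv := O₁.toPartialEquiv
            open_source := O₁.open_source
            open_target := O₁.open_target
            contMDiffOn_toFun := hβ.contMDiff.contMDiffOn
            contMDiffOn_invFun := ?_ }, ?_, rfl⟩
  · refine ContDiffOn.contMDiffOn fun v hv => ContDiffAt.contDiffWithinAt ?_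
    have h2 : O₁.symm v ∈ O₁.source := O₁.map_target hv
    rw [hO₁, OpenPartialHomeomorph.restrOpen_source] at h2
    obtain ⟨T', hT'⟩ := h2.2
    refine O₁.contDiffAt_symm hv (f₀' := T') ?_ hβ.contDiffAt
    rw [hT']
    exact (hβ.differentiable (by simp) _).hasFDerivAt
  · change u ∈ O₁.source
    rw [hO₁, OpenPartialHomeomorph.restrOpen_source]
    exact ⟨hβ.contDiffAt.mem_toOpenPartialHomeomorph_source h1 (by simp), ⟨T, hT⟩⟩

/-- Local bisections with prescribed expression in coordinates. -/
theorem exists_localBisection [CompleteSpace E] (x y : M) {β : E → E} {Φ : E → E →L[ℝ] E}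
    (hβ : ContDiff ℝ ∞ β) (hΦ : ContDiff ℝ ∞ Φ)
    (hy : β (extChartAt 𝓘(ℝ, E) x x) = extChartAt 𝓘(ℝ, E) y y)
    (hβ' : (fderiv ℝ β (extChartAt 𝓘(ℝ, E) x x)).IsInvertible)
    (hΦ' : (Φ (extChartAt 𝓘(ℝ, E) x x)).IsInvertible) :
    ∃ b : LocalBisection E M, x ∈ b.base.source ∧ b.base x = y ∧ ∀ x' ∈ b.base.source,
      x' ∈ (chartAt E x).source ∧ b.base x' ∈ (chartAt E y).source ∧
      jetChart x y (b.toJ1 x') =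
        ((extChartAt 𝓘(ℝ, E) x x', β (extChartAt 𝓘(ℝ, E) x x')), Φ (extChartAt 𝓘(ℝ, E) x x')) := by
  obtain ⟨g, hg, hgβ⟩ := exists_partialDiffeomorph hβ hβ'
  have hW : IsOpen {v : E | (Φ v).IsInvertible} :=
    (ContinuousLinearEquiv.isOpen (𝕜 := ℝ) (E := E) (F := E)).preimage hΦ.continuous
  -- the identity of the open set where `Φ` is invertible, which cuts down the domain
  let w : PartialDiffeomorph 𝓘(ℝ, E) 𝓘(ℝ, E) E E ∞ :=
    { toPartialEquiv := PartialEquiv.ofSet {v : E | (Φ v).IsInvertible}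
      open_source := hW
      open_target := hW
      contMDiffOn_toFun := contMDiffOn_id
      contMDiffOn_invFun := contMDiffOn_id }
  let c := (((chartDiffeo x).trans w).trans g).trans (chartDiffeo y).symm
  have hc : ∀ x', c x' = (extChartAt 𝓘(ℝ, E) y).symm (β (extChartAt 𝓘(ℝ, E) x x')) := by
    intro x'; rw [← hgβ]; rfl
  let F : M → (E × E) × (E →L[ℝ] E) := fun x' =>
    ((extChartAt 𝓘(ℝ, E) x x', β (extChartAt 𝓘(ℝ, E) x x')), Φ (extChartAt 𝓘(ℝ, E) x x'))
  have hs : ∀ x' ∈ c.source, x' ∈ (extChartAt 𝓘(ℝ, E) x).source ∧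
      (Φ (extChartAt 𝓘(ℝ, E) x x')).IsInvertible ∧
      β (extChartAt 𝓘(ℝ, E) x x') ∈ (extChartAt 𝓘(ℝ, E) y).target := by
    intro x' hx'
    have h1 : ((x' ∈ (extChartAt 𝓘(ℝ, E) x).source ∧ (Φ (extChartAt 𝓘(ℝ, E) x x')).IsInvertible) ∧
      extChartAt 𝓘(ℝ, E) x x' ∈ g.source) ∧
      g (extChartAt 𝓘(ℝ, E) x x') ∈ (extChartAt 𝓘(ℝ, E) y).target := hx'
    rw [hgβ] at h1
    exact ⟨h1.1.1.1, h1.1.1.2, h1.2⟩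
  have hF : ∀ x' ∈ c.source, F x' ∈ (jetChart x y : PartialEquiv (J1 E M) _).target := by
    intro x' hx'
    exact mem_jetChart_target.2 ⟨PartialEquiv.map_source _ (hs x' hx').1, (hs x' hx').2.2⟩
  have hF1 : ∀ x' ∈ c.source, mk1 x' (c x') ((jetChart x y).symm (F x')).endo =
      (jetChart x y).symm (F x') := by
    intro x' hx'
    rw [hc, ← jetChart_symm_tgt (hF x' hx')]
    have h1 : x' = ((jetChart x y).symm (F x')).src := by
      rw [jetChart_symm_src (hF x' hx')]
      exact (PartialEquiv.left_inv _ (hs x' hx').1).symm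
    exact congrArg (fun z : M => mk1 z ((jetChart x y).symm (F x')).tgt
      ((jetChart x y).symm (F x')).endo) h1
  have hF2 : ∀ x' ∈ c.source, x' ∈ (chartAt E x).source ∧ c x' ∈ (chartAt E y).source ∧
      jetChart x y (mk1 x' (c x') ((jetChart x y).symm (F x')).endo) = F x' := by
    intro x' hx'
    refine ⟨by simpa using (hs x' hx').1, ?_, ?_⟩
    · rw [hc, ← extChartAt_source 𝓘(ℝ, E)]
      exact PartialEquiv.map_target _ (hs x' hx').2.2
    · rw [hF1 x' hx', PartialEquiv.right_inv _ (hF x' hx')]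
  have hxc : x ∈ c.source := by
    have : ((x ∈ (extChartAt 𝓘(ℝ, E) x).source ∧ (Φ (extChartAt 𝓘(ℝ, E) x x)).IsInvertible) ∧
      extChartAt 𝓘(ℝ, E) x x ∈ g.source) ∧
      g (extChartAt 𝓘(ℝ, E) x x) ∈ (extChartAt 𝓘(ℝ, E) y).target := by
      rw [hgβ, hy]
      exact ⟨⟨⟨mem_extChartAt_source x, hΦ'⟩, hg⟩, mem_extChartAt_target y⟩
    exact this
  refine ⟨{ base := c
            lin := fun x' => ((jetChart x y).symm (F x')).endo
            invertible := ?_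
            smooth := ?_ }, hxc, ?_, hF2⟩
  · intro x' hx'
    obtain ⟨h1, h2, h3⟩ := hF2 x' hx'
    rw [jetChart_mk1 h1 h2] at h3
    obtain ⟨T, hT⟩ := (hs x' hx').2.1
    refine ⟨((chartDEquiv h1).trans T).trans (chartDEquiv h2).symm, ?_⟩
    have h4 : (chartD y (c x')).comp (((jetChart x y).symm (F x')).endo.comp (chartDSymm x x')) =
      Φ (extChartAt 𝓘(ℝ, E) x x') := congrArg Prod.snd h3
    ext (v : E)
    change chartDSymm y (c x') (T (chartD x x' v)) = ((jetChart x y).symm (F x')).endo v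
    have h5 : T (chartD x x' v) = Φ (extChartAt 𝓘(ℝ, E) x x') (chartD x x' v) := by
      rw [← hT]; rfl
    rw [h5, ← h4]
    simp [chartDSymm_chartD h1, chartDSymm_chartD h2]
  · have h1 : ContMDiffOn 𝓘(ℝ, E) 𝓘(ℝ, (E × E) × (E →L[ℝ] E)) ∞ F c.source := by
      have h2 : ContMDiff 𝓘(ℝ, E) 𝓘(ℝ, (E × E) × (E →L[ℝ] E)) ∞ (fun u => ((u, β u), Φ u)) :=
        ((contDiff_id.prodMk hβ).prodMk hΦ).contMDiff
      exact h2.comp_contMDiffOn ((chartDiffeo x).contMDiffOn_toFun.mono fun x' hx' => (hs x' hx').1)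
    exact ((contMDiffOn_jetChart_symm x y).comp h1 hF).congr hF1
  · change c x = y
    rw [hc, hy]
    exact left_inv_chart (mem_chart_source E y)

/-- The linear part of the jet of a bisection given by `β` and `Φ` in coordinates. -/
theorem coordD_jet_of_coord {b : LocalBisection E M} {x y : M} {β : E → E} {Φ : E → E →L[ℝ] E}
    {β' : E →L[ℝ] E} {Φ' : E →L[ℝ] E →L[ℝ] E}
    (hβ : HasFDerivAt β β' (extChartAt 𝓘(ℝ, E) x x))
    (hΦ : HasFDerivAt Φ Φ' (extChartAt 𝓘(ℝ, E) x x)) (hx : x ∈ b.base.source)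
    (h : ∀ x' ∈ b.base.source,
      x' ∈ (chartAt E x).source ∧ b.base x' ∈ (chartAt E y).source ∧
      jetChart x y (b.toJ1 x') =
        ((extChartAt 𝓘(ℝ, E) x x', β (extChartAt 𝓘(ℝ, E) x x')), Φ (extChartAt 𝓘(ℝ, E) x x'))) :
    coordD x y (b.jet x) = ((ContinuousLinearMap.id ℝ E).prod β').prod Φ' := by
  refine coordD_jetAt (f := b.toJ1) (mem_chart_source E x) (JetGroupoid.mem_jetChart_source.2
    ⟨(h x hx).1, (h x hx).2.1⟩) (((hasFDerivAt_id (𝕜 := ℝ) _).prodMk hβ).prodMk hΦ) ?_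
  filter_upwards [b.base.open_source.mem_nhds hx] with x' hx'
  obtain ⟨h1, h2, h3⟩ := h x' hx'
  exact ⟨JetGroupoid.mem_jetChart_source.2 ⟨h1, h2⟩, h3⟩

theorem jetChart_injOn {x₀ y₀ : M} {ξ η : J1 E M} (hξ : ξ ∈ (jetChart x₀ y₀).source)
    (hη : η ∈ (jetChart x₀ y₀).source) (h : jetChart x₀ y₀ ξ = jetChart x₀ y₀ η) : ξ = η :=
  (jetChart x₀ y₀).injOn hξ hη h

theorem mem_jetChart_self (ξ : J1 E M) : ξ ∈ (jetChart ξ.src ξ.tgt).source :=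
  JetGroupoid.mem_jetChart_source.2 ⟨mem_chart_source E _, mem_chart_source E _⟩

/-- An invertible 1-jet is invertible in coordinates. -/
theorem isInvertible_coordLin {ξ : J1 E M} (hξ : ξ.endo.IsInvertible) {x₀ y₀ : M}
    (h : ξ ∈ (jetChart x₀ y₀).source) : (coordLin x₀ y₀ ξ).IsInvertible := by
  obtain ⟨T, hT⟩ := hξ
  obtain ⟨h1, h2⟩ := JetGroupoid.mem_jetChart_source.1 h
  refine ⟨((chartDEquiv h1).symm.trans T).trans (chartDEquiv h2), ?_⟩
  rw [coordLin, ← hT]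
  rfl

/-- A map `β` and a family `Φ` of endomorphisms of the model space, with `φ = dβ = Φ` at the point
under consideration, are the expression in charts of a bisection with semi-holonomic jet, whose
Hessian is `dΦ`. -/
theorem exists_localBisection_jet [CompleteSpace E] {ξ : J1 E M} (hξ : ξ.endo.IsInvertible)
    {β : E → E} {Φ : E → E →L[ℝ] E} {B : E →L[ℝ] E →L[ℝ] E} (hβ : ContDiff ℝ ∞ β)
    (hΦ : ContDiff ℝ ∞ Φ)
    (hy : β (extChartAt 𝓘(ℝ, E) ξ.src ξ.src) = extChartAt 𝓘(ℝ, E) ξ.tgt ξ.tgt)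
    (hβ' : HasFDerivAt β (coordLin ξ.src ξ.tgt ξ) (extChartAt 𝓘(ℝ, E) ξ.src ξ.src))
    (hΦ₀ : Φ (extChartAt 𝓘(ℝ, E) ξ.src ξ.src) = coordLin ξ.src ξ.tgt ξ)
    (hΦ' : HasFDerivAt Φ B (extChartAt 𝓘(ℝ, E) ξ.src ξ.src)) :
    ∃ b : LocalBisection E M, Represents b (b.jet ξ.src) ∧ b.jet ξ.src ∈ SemiHolonomic E M ∧
      (b.jet ξ.src).tgt = ξ ∧ coordHess ξ.src ξ.tgt (b.jet ξ.src) = B ∧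
      ∀ x' ∈ b.base.source,
        x' ∈ (chartAt E ξ.src).source ∧ b.base x' ∈ (chartAt E ξ.tgt).source ∧
        jetChart ξ.src ξ.tgt (b.toJ1 x') = ((extChartAt 𝓘(ℝ, E) ξ.src x',
          β (extChartAt 𝓘(ℝ, E) ξ.src x')), Φ (extChartAt 𝓘(ℝ, E) ξ.src x')) := by
  have hφi := isInvertible_coordLin hξ (mem_jetChart_self ξ)
  obtain ⟨b, hb, -, hc⟩ := exists_localBisection ξ.src ξ.tgt hβ hΦ hy
    (by rwa [hβ'.fderiv]) (by rwa [hΦ₀])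
  have hD := coordD_jet_of_coord hβ' hΦ' hb hc
  have hrep : Represents b (b.jet ξ.src) := ⟨hb, rfl⟩
  have ht : (b.jet ξ.src).tgt = ξ := by
    refine jetChart_injOn (hrep.mem_jetChart_source (mem_chart_source E ξ.src)
      (hc ξ.src hb).2.1) (mem_jetChart_self ξ) ?_
    rw [jetChart_apply (mem_jetChart_self ξ)]
    refine (hc ξ.src hb).2.2.trans ?_
    rw [hy, hΦ₀]
    rfl
  refine ⟨b, hrep, ⟨⟨b, hrep⟩, ?_⟩, ht, ?_, hc⟩
  · rw [p_eq_pStar_iff (B11.tgt_src ⟨b, hrep⟩) (mem_chart_source E ξ.src) (hc ξ.src hb).2.1, ht,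
      coordBase, hD]
    rfl
  · rw [coordHess, hD]
    rfl

/-- There are semi-holonomic jets with prescribed first order part and Hessian. -/
theorem exists_semiHolonomic [CompleteSpace E] {ξ : J1 E M} (hξ : ξ.endo.IsInvertible)
    (B : E →L[ℝ] E →L[ℝ] E) : ∃ A ∈ SemiHolonomic E M, A.tgt = ξ ∧
      coordHess ξ.src ξ.tgt A = B := by
  set φ := coordLin ξ.src ξ.tgt ξ with hφ
  set u₀ := extChartAt 𝓘(ℝ, E) ξ.src ξ.src with hu₀
  have hβ : HasFDerivAt (fun u => extChartAt 𝓘(ℝ, E) ξ.tgt ξ.tgt + φ (u - u₀)) φ u₀ := by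
    simpa using (φ.hasFDerivAt.comp u₀ ((hasFDerivAt_id u₀).sub_const u₀)).const_add
      (extChartAt 𝓘(ℝ, E) ξ.tgt ξ.tgt)
  have hΦ : HasFDerivAt (fun u => φ + B (u - u₀)) B u₀ := by
    simpa using (B.hasFDerivAt.comp u₀ ((hasFDerivAt_id u₀).sub_const u₀)).const_add φ
  obtain ⟨b, -, h1, h2, h3, -⟩ := exists_localBisection_jet hξ
    (contDiff_const.add (φ.contDiff.comp (contDiff_id.sub contDiff_const)))
    (contDiff_const.add (B.contDiff.comp (contDiff_id.sub contDiff_const)))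
    (by simp [hu₀]) hβ (by simp [hφ, hu₀]) hΦ
  exact ⟨_, h1, h2, h3⟩

/-! ### Jets commuting with a symmetry jet -/

theorem coordLin_comp {x y z x₀ y₀ z₀ : M} (hy : y ∈ (chartAt E y₀).source)
    (ψ φ : E →L[ℝ] E) : coordLin x₀ z₀ (mk1 x z (ψ.comp φ)) =
      (coordLin y₀ z₀ (mk1 y z ψ)).comp (coordLin x₀ y₀ (mk1 x y φ)) := by
  ext v
  simp [coordLin, chartDSymm_chartD hy]

theorem coordLin_id {x x₀ : M} (hx : x ∈ (chartAt E x₀).source) :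
    coordLin x₀ x₀ (mk1 x x (ContinuousLinearMap.id ℝ E)) = ContinuousLinearMap.id ℝ E := by
  ext v
  simp [coordLin, chartD_chartDSymm hx]

theorem coordLin_neg_id {x x₀ : M} (hx : x ∈ (chartAt E x₀).source) :
    coordLin x₀ x₀ (mk1 x x (-ContinuousLinearMap.id ℝ E)) = -ContinuousLinearMap.id ℝ E := by
  ext v
  simp [coordLin, chartD_chartDSymm hx]

theorem SymmetryJet.tgt_eq (s : SymmetryJet E M) (x : M) :
    (s.toFun x : J11 E M).tgt = mk1 x x (-ContinuousLinearMap.id ℝ E) := s.p_eq x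

theorem SymmetryJet.coordLin_eq (s : SymmetryJet E M) {x₀ x : M}
    (hx : x ∈ (chartAt E x₀).source) :
    coordLin x₀ x₀ (s.toFun x : J11 E M).tgt = -ContinuousLinearMap.id ℝ E := by
  rw [s.tgt_eq, coordLin_neg_id hx]

theorem SymmetryJet.coordBase_eq (s : SymmetryJet E M) {x₀ x : M}
    (hx : x ∈ (chartAt E x₀).source) :
    coordBase x₀ x₀ (s.toFun x : J11 E M) = -ContinuousLinearMap.id ℝ E := by
  rw [SemiHolonomic.coordBase_eq (s.toFun x).2 (by rwa [s.source_eq]) (by rwa [s.tgt_eq, mk1_tgt]),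
    s.coordLin_eq hx]

/-- The Hessian of `𝔰(x)` in the chart around `x₀`. -/
def SymmetryJet.hess (s : SymmetryJet E M) (x₀ x : M) : E →L[ℝ] E →L[ℝ] E :=
  coordHess x₀ x₀ (s.toFun x : J11 E M)

/-- The Hessian of the affine extension of a 1-jet `ξ : T_x M → T_y M` with expression `φ` in
coordinates: the bilinear map `(v, w) ↦ ½ (σ_y(φ v, φ w) - φ (σ_x(v, w)))`, where `σ` is the Hessian
of the symmetry jet. -/
def SymmetryJet.extHess (s : SymmetryJet E M) (x₀ y₀ : M) (ξ : J1 E M) : E →L[ℝ] E →L[ℝ] E :=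
  (1 / 2 : ℝ) • (((ContinuousLinearMap.compL ℝ E E E).flip (coordLin x₀ y₀ ξ)).comp
      ((s.hess y₀ ξ.tgt).comp (coordLin x₀ y₀ ξ)) -
    (ContinuousLinearMap.compL ℝ E E E (coordLin x₀ y₀ ξ)).comp (s.hess x₀ ξ.src))

theorem SymmetryJet.extHess_apply (s : SymmetryJet E M) (x₀ y₀ : M) (ξ : J1 E M) (v w : E) :
    s.extHess x₀ y₀ ξ v w = (1 / 2 : ℝ) • (s.hess y₀ ξ.tgt (coordLin x₀ y₀ ξ v) (coordLin x₀ y₀ ξ w)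
      - coordLin x₀ y₀ ξ (s.hess x₀ ξ.src v w)) := rfl

/-- A semi-holonomic jet `A` over `ξ : T_x M → T_y M` commutes with the symmetry jet, that is
`A · 𝔰(x) = 𝔰(y) · A`, exactly if its Hessian is the one of the affine extension.  In particular
the latter condition does not depend on the charts. -/
theorem SymmetryJet.commute_iff (s : SymmetryJet E M) {A : J11 E M} (hA : A ∈ SemiHolonomic E M)
    {b b' sx sy : LocalBisection E M} (hb : Represents b A) (hb' : Represents b' A)
    (hsx : Represents sx (s.toFun A.src : J11 E M))
    (hsy : Represents sy (s.toFun A.tgt.tgt : J11 E M))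
    {x₀ y₀ : M} (hx : A.src ∈ (chartAt E x₀).source) (hy : A.tgt.tgt ∈ (chartAt E y₀).source) :
    jetAt 𝓘(ℝ, E) (J1model E) (b.mul sx) A.src = jetAt 𝓘(ℝ, E) (J1model E) (sy.mul b') A.src ↔
      coordHess x₀ y₀ A = s.extHess x₀ y₀ A.tgt := by
  have h1 : A.src = sx.base (s.toFun A.src : J11 E M).src := by
    rw [hsx.base_eq, s.tgt_eq, mk1_tgt]
  have h2 : (s.toFun A.tgt.tgt : J11 E M).src = b'.base A.src := by
    rw [hb'.base_eq, s.source_eq]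
  have hx1 : (s.toFun A.src : J11 E M).src ∈ (chartAt E x₀).source := by rwa [s.source_eq]
  have hy1 : (s.toFun A.tgt.tgt : J11 E M).src ∈ (chartAt E y₀).source := by rwa [s.source_eq]
  have hy2 : (s.toFun A.tgt.tgt : J11 E M).tgt.tgt ∈ (chartAt E y₀).source := by
    rwa [s.tgt_eq, mk1_tgt]
  have c1 := coordD_mul hb hsx h1 hx1 hx hy
  have c2 := coordD_mul hsy hb' h2 hx hy1 hy2
  rw [s.source_eq, s.coordBase_eq hx, s.coordLin_eq hx] at c1
  rw [s.coordBase_eq hy, s.coordLin_eq hy] at c2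
  rw [SemiHolonomic.coordBase_eq hA hx hy] at c1 c2
  -- With `φ` and `B` the linear part and the Hessian of `A`, the two products have the Hessians
  -- `φ σ_x(v, w) + B(v, w)` and `-B(v, w) + σ_y(φ v, φ w)`.
  have key : coordHess x₀ y₀ A = s.extHess x₀ y₀ A.tgt ↔
      coordD x₀ y₀ (jetAt 𝓘(ℝ, E) (J1model E) (b.mul sx) A.src) =
      coordD x₀ y₀ (jetAt 𝓘(ℝ, E) (J1model E) (sy.mul b') A.src) := by
    have hsrc : A.tgt.src = A.src := B11.tgt_src hA.1
    rw [c1, c2]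
    constructor
    · intro h
      ext1 v
      refine Prod.ext (Prod.ext rfl (by simp)) ?_
      ext w
      have h3 := congrArg (fun T : E →L[ℝ] E →L[ℝ] E => T v w) h
      simp only [s.extHess_apply, hsrc] at h3
      simp only [ContinuousLinearMap.prod_apply, add_apply,
        ContinuousLinearMap.comp_apply, ContinuousLinearMap.compL_apply,
        ContinuousLinearMap.flip_apply, neg_apply, map_neg,
        ContinuousLinearMap.id_apply, neg_neg, h3, SymmetryJet.hess]
      module
    · intro h
      ext v w
      have h3 := congrArg (fun T : E →L[ℝ] (E × E) × (E →L[ℝ] E) => (T v).2 w) h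
      simp only [ContinuousLinearMap.prod_apply, add_apply,
        ContinuousLinearMap.comp_apply, ContinuousLinearMap.compL_apply,
        ContinuousLinearMap.flip_apply, neg_apply, map_neg,
        ContinuousLinearMap.id_apply, neg_neg] at h3
      rw [s.extHess_apply, hsrc, SymmetryJet.hess, SymmetryJet.hess]
      linear_combination (norm := module) (1 / 2 : ℝ) • h3
  rw [key]
  refine ⟨fun h => by rw [h], fun h => J11_ext rfl ?_ hx ?_ h⟩
  · change mk1 A.src (b.base (sx.base A.src)) ((b.endo (sx.base A.src)).comp (sx.endo A.src)) =
      mk1 A.src (sy.base (b'.base A.src)) ((sy.endo (b'.base A.src)).comp (b'.endo A.src))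
    have e1 : sx.base A.src = A.src := by rw [← s.source_eq A.src, ← h1, s.source_eq]
    have e2 : sx.endo A.src = -ContinuousLinearMap.id ℝ E := by
      have := hsx.lin_eq; rwa [s.source_eq, s.tgt_eq, mk1_endo] at this
    have e3 : sy.base A.tgt.tgt = A.tgt.tgt := by
      have := hsy.base_eq; rwa [s.source_eq, s.tgt_eq, mk1_tgt] at this
    have e4 : sy.endo A.tgt.tgt = -ContinuousLinearMap.id ℝ E := by
      have := hsy.lin_eq; rwa [s.source_eq, s.tgt_eq, mk1_endo] at this
    rw [e1, e2, hb.base_eq, hb.lin_eq, hb'.base_eq, hb'.lin_eq, e3, e4]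
    congr 1
    ext v
    simp
  · refine JetGroupoid.mem_jetChart_source.2 ⟨hx, ?_⟩
    change b.base (sx.base A.src) ∈ _
    have e1 : sx.base A.src = A.src := by rw [← s.source_eq A.src, ← h1, s.source_eq]
    rwa [e1, hb.base_eq]

/-- The condition characterizing the affine extension does not depend on the charts. -/
theorem SymmetryJet.hess_eq_extHess_of_charts (s : SymmetryJet E M) {A : J11 E M}
    (hA : A ∈ SemiHolonomic E M) {x₀ y₀ x₁ y₁ : M} (hx : A.src ∈ (chartAt E x₀).source)
    (hy : A.tgt.tgt ∈ (chartAt E y₀).source) (hx' : A.src ∈ (chartAt E x₁).source)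
    (hy' : A.tgt.tgt ∈ (chartAt E y₁).source) (h : coordHess x₀ y₀ A = s.extHess x₀ y₀ A.tgt) :
    coordHess x₁ y₁ A = s.extHess x₁ y₁ A.tgt := by
  obtain ⟨b, hb⟩ := hA.1
  obtain ⟨sx, hsx⟩ := (s.toFun A.src).2.1
  obtain ⟨sy, hsy⟩ := (s.toFun A.tgt.tgt).2.1
  rw [← s.commute_iff hA hb hb hsx hsy hx' hy', s.commute_iff hA hb hb hsx hsy hx hy]
  exact h

/-! ### The affine extension -/

section Extension

variable [FiniteDimensional ℝ E]

theorem GLTM.isInvertible (ξ : GLTM E M) : (ξ : J1 E M).endo.IsInvertible := ξ.2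

/-- The affine extension of a symmetry jet exists pointwise. -/
theorem SymmetryJet.exists_extension (s : SymmetryJet E M) (ξ : GLTM E M) :
    ∃ A : SemiHolonomic E M, (A : J11 E M).tgt = ξ ∧ coordHess (ξ : J1 E M).src (ξ : J1 E M).tgt
      (A : J11 E M) = s.extHess (ξ : J1 E M).src (ξ : J1 E M).tgt ξ := by
  have : CompleteSpace E := FiniteDimensional.complete ℝ E
  obtain ⟨A, h1, h2, h3⟩ := exists_semiHolonomic (GLTM.isInvertible ξ)
    (s.extHess (ξ : J1 E M).src (ξ : J1 E M).tgt ξ)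
  exact ⟨⟨A, h1⟩, h2, h3⟩

/-- The affine extension `S` of a symmetry jet: `S(ξ)` is the unique semi-holonomic jet over
`ξ : T_x M → T_y M` such that `S(ξ) · 𝔰(x) = 𝔰(y) · S(ξ)`.  It is selected by its Hessian in the
charts around `x` and `y`. -/
def SymmetryJet.extension (s : SymmetryJet E M) (ξ : GLTM E M) : SemiHolonomic E M :=
  (s.exists_extension ξ).choose

variable (s : SymmetryJet E M)

theorem SymmetryJet.extension_tgt (ξ : GLTM E M) : (s.extension ξ : J11 E M).tgt = ξ :=
  (s.exists_extension ξ).choose_spec.1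

theorem SymmetryJet.extension_src (ξ : GLTM E M) :
    (s.extension ξ : J11 E M).src = (ξ : J1 E M).src := by
  rw [← B11.tgt_src (s.extension ξ).2.1, s.extension_tgt]

/-- The Hessian of the affine extension is given by the same formula in all charts, although it is
prescribed only in those around the source and the target. -/
theorem SymmetryJet.coordHess_extension (ξ : GLTM E M) {x₀ y₀ : M}
    (hx : (ξ : J1 E M).src ∈ (chartAt E x₀).source)
    (hy : (ξ : J1 E M).tgt ∈ (chartAt E y₀).source) :
    coordHess x₀ y₀ (s.extension ξ : J11 E M) = s.extHess x₀ y₀ ξ := by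
  have h := (s.exists_extension ξ).choose_spec.2
  have h1 := s.hess_eq_extHess_of_charts (A := (s.extension ξ : J11 E M)) (s.extension ξ).2
    (x₀ := (ξ : J1 E M).src) (y₀ := (ξ : J1 E M).tgt) (x₁ := x₀) (y₁ := y₀)
    (by rw [s.extension_src]; exact mem_chart_source E _)
    (by rw [s.extension_tgt]; exact mem_chart_source E _)
    (by rwa [s.extension_src]) (by rwa [s.extension_tgt])
    (by rw [s.extension_tgt]; exact h)
  rwa [s.extension_tgt] at h1

theorem SymmetryJet.coordD_extension (ξ : GLTM E M) {x₀ y₀ : M}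
    (hx : (ξ : J1 E M).src ∈ (chartAt E x₀).source)
    (hy : (ξ : J1 E M).tgt ∈ (chartAt E y₀).source) :
    coordD x₀ y₀ (s.extension ξ : J11 E M) =
      ((ContinuousLinearMap.id ℝ E).prod (coordLin x₀ y₀ ξ)).prod (s.extHess x₀ y₀ ξ) := by
  have hx' : (s.extension ξ : J11 E M).src ∈ (chartAt E x₀).source := by rwa [s.extension_src]
  have hy' : (s.extension ξ : J11 E M).tgt.tgt ∈ (chartAt E y₀).source := by
    rwa [s.extension_tgt]
  rw [B11.coordD_eq (s.extension ξ).2.1 hx' hy', s.coordHess_extension ξ hx hy,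
    SemiHolonomic.coordBase_eq (s.extension ξ).2 hx' hy', s.extension_tgt]

/-- A semi-holonomic jet with the Hessian of the affine extension is its value. -/
theorem SymmetryJet.eq_extension {A : SemiHolonomic E M} {ξ : GLTM E M}
    (ht : (A : J11 E M).tgt = ξ) {x₀ y₀ : M} (hx : (ξ : J1 E M).src ∈ (chartAt E x₀).source)
    (hy : (ξ : J1 E M).tgt ∈ (chartAt E y₀).source)
    (h : coordHess x₀ y₀ (A : J11 E M) = s.extHess x₀ y₀ ξ) : A = s.extension ξ := by
  have hs : (A : J11 E M).src = (ξ : J1 E M).src := by rw [← B11.tgt_src A.2.1, ht]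
  refine Subtype.ext (SemiHolonomic.ext A.2 (s.extension ξ).2 (x₀ := x₀) (y₀ := y₀) ?_ ?_ ?_ ?_)
  · rw [ht, s.extension_tgt]
  · rwa [hs]
  · rwa [ht]
  · rw [h, s.coordHess_extension ξ hx hy]

set_option synthInstance.maxHeartbeats 200000 in
theorem SymmetryJet.contMDiffAt_hess (x : M) :
    ContMDiffAt 𝓘(ℝ, E) 𝓘(ℝ, E →L[ℝ] E →L[ℝ] E) ∞ (s.hess x) x := by
  have h := ((contMDiffAt_J11_iff (f := fun x => (s.toFun x : J11 E M))
    (B11.tgt_src (s.toFun x).2.1)).1 (s.smooth x)).2.2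
  rw [s.source_eq, s.tgt_eq, mk1_tgt] at h
  exact (contMDiffAt_const (c := ContinuousLinearMap.snd ℝ (E × E) (E →L[ℝ] E))).clm_comp h

theorem contMDiffAt_coordLin (ξ : J1 E M) :
    ContMDiffAt (J1model E) 𝓘(ℝ, E →L[ℝ] E) ∞ (coordLin ξ.src ξ.tgt) ξ := by
  have h1 := (contMDiffOn_jetChart ξ.src ξ.tgt).contMDiffAt
    ((isOpen_jetChart_source ξ.src ξ.tgt).mem_nhds (mem_jetChart_self ξ))
  have h2 := ((ContinuousLinearMap.snd ℝ (E × E) (E →L[ℝ] E)).contMDiff.contMDiffAt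
    (n := ∞)).comp ξ h1
  refine h2.congr_of_eventuallyEq ?_
  filter_upwards [(isOpen_jetChart_source ξ.src ξ.tgt).mem_nhds (mem_jetChart_self ξ)] with η hη
  simp only [Function.comp_apply, jetChart_apply hη]
  rfl

theorem SymmetryJet.contMDiffAt_extHess (ξ : J1 E M) :
    ContMDiffAt (J1model E) 𝓘(ℝ, E →L[ℝ] E →L[ℝ] E) ∞ (s.extHess ξ.src ξ.tgt) ξ := by
  have h1 := contMDiffAt_coordLin ξ
  have h2 := (s.contMDiffAt_hess ξ.src).comp ξ (contMDiff_src ξ)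
  have h3 := (s.contMDiffAt_hess ξ.tgt).comp ξ (contMDiff_tgt ξ)
  have h4 := ((ContinuousLinearMap.compL ℝ E E E).contMDiff.contMDiffAt (n := ∞)).comp ξ h1
  have h5 := ((ContinuousLinearMap.compL ℝ E E E).flip.contMDiff.contMDiffAt (n := ∞)).comp ξ h1
  exact (contMDiffAt_const (I' := 𝓘(ℝ, ℝ)) (c := (1 / 2 : ℝ))).smul
    ((h5.clm_comp (h3.clm_comp h1)).sub (h4.clm_comp h2))

set_option synthInstance.maxHeartbeats 200000 in
theorem SymmetryJet.contMDiff_extension :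
    ContMDiff (J1model E) (J11model E) ∞ (fun ξ => (s.extension ξ : J11 E M)) := by
  intro ξ
  have hv : ContMDiffAt (J1model E) (J1model E) ∞ (fun η : GLTM E M => (η : J1 E M)) ξ :=
    contMDiff_subtype_val ξ
  rw [contMDiffAt_J11_iff (by rw [s.extension_tgt, s.extension_src])]
  simp only [s.extension_tgt, s.extension_src]
  refine ⟨(contMDiff_src (ξ : J1 E M)).comp ξ hv, hv, ?_⟩
  have h1 := (contMDiffAt_coordLin (ξ : J1 E M)).comp ξ hv
  have h2 := (s.contMDiffAt_extHess (ξ : J1 E M)).comp ξ hv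
  have h3 : ContMDiffAt (J1model E) 𝓘(ℝ, E →L[ℝ] E × E) ∞ (fun η : GLTM E M =>
      ContinuousLinearMap.inl ℝ E E + (ContinuousLinearMap.inr ℝ E E).comp
        (coordLin (ξ : J1 E M).src (ξ : J1 E M).tgt (η : J1 E M))) ξ :=
    contMDiffAt_const.add (contMDiffAt_const.clm_comp h1)
  have h4 : ContMDiffAt (J1model E) 𝓘(ℝ, E →L[ℝ] (E × E) × (E →L[ℝ] E)) ∞ (fun η : GLTM E M =>
      (ContinuousLinearMap.inl ℝ (E × E) (E →L[ℝ] E)).comp (ContinuousLinearMap.inl ℝ E E +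
        (ContinuousLinearMap.inr ℝ E E).comp
          (coordLin (ξ : J1 E M).src (ξ : J1 E M).tgt (η : J1 E M))) +
      (ContinuousLinearMap.inr ℝ (E × E) (E →L[ℝ] E)).comp
        (s.extHess (ξ : J1 E M).src (ξ : J1 E M).tgt (η : J1 E M))) ξ :=
    (contMDiffAt_const.clm_comp h3).add (contMDiffAt_const.clm_comp h2)
  refine h4.congr_of_eventuallyEq ?_
  have h6 := hv.continuousAt ((isOpen_jetChart_source (ξ : J1 E M).src (ξ : J1 E M).tgt).mem_nhds
    (mem_jetChart_self (ξ : J1 E M)))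
  filter_upwards [h6] with η hη
  obtain ⟨h7, h8⟩ := JetGroupoid.mem_jetChart_source.1 hη
  rw [s.coordD_extension η h7 h8]
  ext1 v
  refine Prod.ext (Prod.ext ?_ ?_) ?_ <;> simp

theorem coordD_unit (x : M) : coordD x x (unit x : J11 E M) =
    ((ContinuousLinearMap.id ℝ E).prod (ContinuousLinearMap.id ℝ E)).prod 0 := by
  refine coordD_jetAt (f := fun x' => mk1 x' x' (ContinuousLinearMap.id ℝ E))
    (mem_chart_source E x) (JetGroupoid.mem_jetChart_source.2
    ⟨mem_chart_source E x, mem_chart_source E x⟩) (((hasFDerivAt_id (𝕜 := ℝ) _).prodMk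
      (hasFDerivAt_id (𝕜 := ℝ) _)).prodMk (hasFDerivAt_const (ContinuousLinearMap.id ℝ E) _)) ?_
  filter_upwards [(chartAt E x).open_source.mem_nhds (mem_chart_source E x)] with x' hx'
  refine ⟨JetGroupoid.mem_jetChart_source.2 ⟨hx', hx'⟩, ?_⟩
  refine (jetChart_mk1 (φ := ContinuousLinearMap.id ℝ E) hx' hx').trans ?_
  exact Prod.ext rfl (coordLin_id hx')

/-- Every element of `GL(TM)` comes from a linear isomorphism. -/
theorem GLTM.exists_of (ξ : GLTM E M) : ∃ φ : TangentSpace 𝓘(ℝ, E) (ξ : J1 E M).src ≃L[ℝ]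
    TangentSpace 𝓘(ℝ, E) (ξ : J1 E M).tgt, ξ = GLTM.of φ := by
  obtain ⟨φ, hφ⟩ := ξ.2
  refine ⟨φ, Subtype.ext ?_⟩
  change OneJet.of 𝓘(ℝ, E) 𝓘(ℝ, E) _ _ (ξ : J1 E M).lin = _
  rw [← hφ]
  rfl

/-- The Hessian of `S(I_x)` is `½ (σ_x - σ_x) = 0`. -/
theorem SymmetryJet.extension_unit (x : M) :
    (s.extension (GLTM.of (ContinuousLinearEquiv.refl ℝ (TangentSpace 𝓘(ℝ, E) x))) : J11 E M) =
      unit x := by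
  have ht : (GLTM.of (ContinuousLinearEquiv.refl ℝ (TangentSpace 𝓘(ℝ, E) x)) : J1 E M) =
    mk1 x x (ContinuousLinearMap.id ℝ E) := rfl
  refine J11_ext (x₀ := x) (y₀ := x) ?_ ?_ ?_ ?_ ?_
  · rw [s.extension_src]; rfl
  · rw [s.extension_tgt]; rfl
  · rw [s.extension_src]; exact mem_chart_source E x
  · rw [s.extension_tgt]; exact mem_jetChart_self (mk1 x x _)
  · rw [s.coordD_extension _ (mem_chart_source E x) (mem_chart_source E x), coordD_unit, ht,
      coordLin_id (mem_chart_source E x)]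
    congr 1
    ext v w
    simp [s.extHess_apply, coordLin_id (mem_chart_source E x)]

/-- The Hessian of `S(-I_x)` is `½ (σ_x + σ_x) = σ_x`. -/
theorem SymmetryJet.extension_neg (x : M) :
    s.extension (GLTM.of (ContinuousLinearEquiv.neg ℝ :
      TangentSpace 𝓘(ℝ, E) x ≃L[ℝ] TangentSpace 𝓘(ℝ, E) x)) = s.toFun x := by
  have ht : (GLTM.of (ContinuousLinearEquiv.neg ℝ :
      TangentSpace 𝓘(ℝ, E) x ≃L[ℝ] TangentSpace 𝓘(ℝ, E) x) : J1 E M) =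
    mk1 x x (-ContinuousLinearMap.id ℝ E) := rfl
  refine (s.eq_extension (x₀ := x) (y₀ := x) ((s.tgt_eq x).trans ht.symm) (mem_chart_source E x)
    (mem_chart_source E x) ?_).symm
  rw [ht]
  ext v w
  simp only [s.extHess_apply, coordLin_neg_id (mem_chart_source E x), mk1_src, mk1_tgt,
    neg_apply, map_neg, ContinuousLinearMap.id_apply, SymmetryJet.hess]
  module

/-- Compatibility with products: the terms in the Hessian at the intermediate point `y` cancel. -/
theorem SymmetryJet.extension_mul (x y z : M)
    (φ : TangentSpace 𝓘(ℝ, E) x ≃L[ℝ] TangentSpace 𝓘(ℝ, E) y)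
    (ψ : TangentSpace 𝓘(ℝ, E) y ≃L[ℝ] TangentSpace 𝓘(ℝ, E) z) :
    IsProduct (s.extension (GLTM.of ψ) : J11 E M) (s.extension (GLTM.of φ) : J11 E M)
      (s.extension (GLTM.of (φ.trans ψ)) : J11 E M) := by
  obtain ⟨b₁, h₁⟩ := (s.extension (GLTM.of φ)).2.1
  obtain ⟨b₂, h₂⟩ := (s.extension (GLTM.of ψ)).2.1
  let φ' : E →L[ℝ] E := (φ : TangentSpace 𝓘(ℝ, E) x →L[ℝ] TangentSpace 𝓘(ℝ, E) y)
  let ψ' : E →L[ℝ] E := (ψ : TangentSpace 𝓘(ℝ, E) y →L[ℝ] TangentSpace 𝓘(ℝ, E) z)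
  have t1 : (GLTM.of φ : J1 E M) = mk1 x y φ' := rfl
  have t2 : (GLTM.of ψ : J1 E M) = mk1 y z ψ' := rfl
  have t3 : (GLTM.of (φ.trans ψ) : J1 E M) = mk1 x z (ψ'.comp φ') := rfl
  have r1 : b₁.base x = y := by
    have := h₁.base_eq; rwa [s.extension_src, s.extension_tgt] at this
  have r2 : b₂.base y = z := by
    have := h₂.base_eq; rwa [s.extension_src, s.extension_tgt] at this
  have r3 : b₁.endo x = φ' := by
    have := h₁.lin_eq; rwa [s.extension_src, s.extension_tgt] at this
  have r4 : b₂.endo y = ψ' := by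
    have := h₂.lin_eq; rwa [s.extension_src, s.extension_tgt] at this
  have hy : (s.extension (GLTM.of ψ) : J11 E M).src =
      b₁.base (s.extension (GLTM.of φ) : J11 E M).src := by
    rw [h₁.base_eq, s.extension_src, s.extension_tgt]; rfl
  have hm : b₂.mul b₁ x = mk1 x z (ψ'.comp φ') := by
    change mk1 x (b₂.base (b₁.base x)) ((b₂.endo (b₁.base x)).comp (b₁.endo x)) = _
    rw [r1, r2, r3, r4]
  refine ⟨b₂, b₁, h₁, h₂, hy, ?_⟩
  have hD := coordD_mul h₂ h₁ hy (x₀ := x) (y₀ := y) (z₀ := z)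
    (by rw [s.extension_src]; exact mem_chart_source E x)
    (by rw [s.extension_src]; exact mem_chart_source E y)
    (by rw [s.extension_tgt]; exact mem_chart_source E z)
  have hs1 : (s.extension (GLTM.of φ) : J11 E M).src = x := s.extension_src _
  rw [SemiHolonomic.coordBase_eq (s.extension (GLTM.of φ)).2
      (by rw [s.extension_src]; exact mem_chart_source E x)
      (by rw [s.extension_tgt]; exact mem_chart_source E y),
    SemiHolonomic.coordBase_eq (s.extension (GLTM.of ψ)).2
      (by rw [s.extension_src]; exact mem_chart_source E y)
      (by rw [s.extension_tgt]; exact mem_chart_source E z),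
    s.coordHess_extension (GLTM.of φ) (mem_chart_source E x) (mem_chart_source E y),
    s.coordHess_extension (GLTM.of ψ) (mem_chart_source E y) (mem_chart_source E z),
    s.extension_tgt, s.extension_tgt, hs1, t1, t2] at hD
  rw [hs1]
  refine J11_ext (x₀ := x) (y₀ := z) ?_ ?_ ?_ ?_ ?_
  · rw [s.extension_src]; rfl
  · rw [s.extension_tgt, jetAt_tgt, hm]; rfl
  · rw [s.extension_src]; exact mem_chart_source E x
  · rw [s.extension_tgt]; exact mem_jetChart_self (mk1 x z _)
  · rw [hD, s.coordD_extension _ (mem_chart_source E x) (mem_chart_source E z), t3,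
      coordLin_comp (mem_chart_source E y)]
    congr 1
    ext v w
    simp only [s.extHess_apply, coordLin_comp (x := x) (z := z) (x₀ := x) (z₀ := z)
      (mem_chart_source E y), mk1_src, mk1_tgt, add_apply,
        ContinuousLinearMap.comp_apply, ContinuousLinearMap.compL_apply,
        ContinuousLinearMap.flip_apply, map_smul, map_sub]
    module

theorem SymmetryJet.isAffineExtension : IsAffineExtension s s.extension where
  morphism :=
    { smooth := s.contMDiff_extension
      source_eq := s.extension_src
      target_eq := fun ξ => by rw [s.extension_tgt]
      map_unit := s.extension_unit
      map_mul := s.extension_mul }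
  section_p := s.extension_tgt
  extends_s := s.extension_neg

/-- Any affine extension commutes with the symmetry jet, because `-I` is central. -/
theorem SymmetryJet.extension_unique {S : GLTM E M → SemiHolonomic E M}
    (hS : IsAffineExtension s S) : S = s.extension := by
  funext ξ
  obtain ⟨x, y, φ, rfl⟩ : ∃ (x y : M)
      (φ : TangentSpace 𝓘(ℝ, E) x ≃L[ℝ] TangentSpace 𝓘(ℝ, E) y), ξ = GLTM.of φ :=
    ⟨_, _, GLTM.exists_of ξ⟩
  have ht : (S (GLTM.of φ) : J11 E M).tgt = (GLTM.of φ : GLTM E M) := hS.section_p _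
  have hs : (S (GLTM.of φ) : J11 E M).src = x := hS.morphism.source_eq _
  obtain ⟨b, sx, h1, h2, h3, h4⟩ := hS.morphism.map_mul x x y (ContinuousLinearEquiv.neg ℝ) φ
  obtain ⟨sy, b', h1', h2', h3', h4'⟩ := hS.morphism.map_mul x y y φ (ContinuousLinearEquiv.neg ℝ)
  rw [hS.extends_s] at h1 h2' h3' h4
  -- `φ ∘ (-I_x) = (-I_y) ∘ φ`, and `S` is applied to both factorizations
  have hc : (ContinuousLinearEquiv.neg ℝ : TangentSpace 𝓘(ℝ, E) x ≃L[ℝ] _).trans φ =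
      φ.trans (ContinuousLinearEquiv.neg ℝ) := by
    ext v; simp
  rw [hc] at h4
  have h5 := h4.symm.trans h4'
  rw [s.source_eq] at h5
  have ht' : (S (GLTM.of φ) : J11 E M).tgt.tgt = y := by rw [ht]; rfl
  refine s.eq_extension ht (mem_chart_source E x) (mem_chart_source E y) ?_
  rw [← ht]
  refine (s.commute_iff (S (GLTM.of φ)).2 h2 h1' (sx := sx) (sy := sy) ?_ ?_ ?_ ?_).1 ?_
  · rwa [hs]
  · rwa [ht']
  · rw [hs]; exact mem_chart_source E x
  · rw [ht']; exact mem_chart_source E y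
  · rw [hs] at h5 ⊢; exact h5

end Extension

/-! ### Vector fields in coordinates -/

/-- A tangent vector read in the chart around `x₀`.  This is the value of `chartD x₀ x`, with the
tangent space `T_x M` as its domain instead of the model space. -/
def tangentCoord (x₀ : M) {x : M} (v : TangentSpace 𝓘(ℝ, E) x) : E :=
  (chartD x₀ x : E →L[ℝ] E) v

theorem tangentCoord_injective {x₀ x : M} (hx : x ∈ (chartAt E x₀).source) :
    Function.Injective (tangentCoord (E := E) x₀ (x := x)) :=
  (chartDEquiv (E := E) hx).injective

theorem tangentCoord_add (x₀ : M) {x : M} (v w : TangentSpace 𝓘(ℝ, E) x) :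
    tangentCoord x₀ (v + w) = tangentCoord x₀ v + tangentCoord x₀ w :=
  map_add (chartD x₀ x : E →L[ℝ] E) v w

theorem tangentCoord_smul (x₀ : M) {x : M} (c : ℝ) (v : TangentSpace 𝓘(ℝ, E) x) :
    tangentCoord x₀ (c • v) = c • tangentCoord x₀ v :=
  map_smul (chartD x₀ x : E →L[ℝ] E) c v

/-- The action of a bisection on tangent vectors in coordinates. -/
theorem tangentCoord_lin (b : LocalBisection E M) {x₀ x : M} (y₀ : M)
    (hx : x ∈ (chartAt E x₀).source) (v : TangentSpace 𝓘(ℝ, E) x) :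
    tangentCoord y₀ (b.lin x v) = coordLin x₀ y₀ (b.toJ1 x) (tangentCoord x₀ v) := by
  have h : chartDSymm x₀ x (tangentCoord x₀ v) = v := chartDSymm_chartD hx v
  rw [b.toJ1_eq, coordLin, mk1_src, mk1_tgt, mk1_endo, ContinuousLinearMap.comp_apply,
    ContinuousLinearMap.comp_apply, h]
  rfl

/-- A vector field read in the chart around `x₀`. -/
def fieldCoord (x₀ : M) (Y : ∀ x : M, TangentSpace 𝓘(ℝ, E) x) (u : E) : E :=
  tangentCoord x₀ (Y ((extChartAt 𝓘(ℝ, E) x₀).symm u))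

theorem fieldCoord_self (x : M) (Y : ∀ x : M, TangentSpace 𝓘(ℝ, E) x) :
    fieldCoord x Y (extChartAt 𝓘(ℝ, E) x x) = tangentCoord x (Y x) := by
  rw [fieldCoord, left_inv_chart (mem_chart_source E x)]

theorem inverse_chartD {x₀ x : M} (hx : x ∈ (chartAt E x₀).source) :
    (chartD x₀ x : E →L[ℝ] E).inverse = chartDSymm x₀ x :=
  ContinuousLinearMap.inverse_eq (chartD_comp_chartDSymm hx) (chartDSymm_comp_chartD hx)

theorem inverse_chartDSymm {x₀ x : M} (hx : x ∈ (chartAt E x₀).source) :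
    (chartDSymm x₀ x : E →L[ℝ] E).inverse = chartD x₀ x :=
  ContinuousLinearMap.inverse_eq (chartDSymm_comp_chartD hx) (chartD_comp_chartDSymm hx)

/-- The pullback of a vector field along the inverse of a chart, which occurs in the definition of
the Lie bracket on `M`, is its expression in the chart. -/
theorem mpullbackWithin_chart_symm (x : M) (Y : ∀ x : M, TangentSpace 𝓘(ℝ, E) x) :
    (VectorField.mpullbackWithin 𝓘(ℝ, E) 𝓘(ℝ, E) (extChartAt 𝓘(ℝ, E) x).symm Y
      (range 𝓘(ℝ, E)) : E → E) =ᶠ[𝓝 (extChartAt 𝓘(ℝ, E) x x)] fieldCoord x Y := by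
  filter_upwards [(isOpen_extChartAt_target (I := 𝓘(ℝ, E)) x).mem_nhds (mem_extChartAt_target x)]
    with u hu
  have h1 : (extChartAt 𝓘(ℝ, E) x).symm u ∈ (chartAt E x).source := by
    rw [← extChartAt_source 𝓘(ℝ, E)]
    exact PartialEquiv.map_target _ hu
  have h2 := inverse_chartDSymm h1
  rw [chartDSymm, PartialEquiv.right_inv _ hu] at h2
  rw [VectorField.mpullbackWithin_apply, modelWithCornersSelf_coe, range_id, mfderivWithin_univ]
  exact congrArg (fun T : E →L[ℝ] E => T (Y ((extChartAt 𝓘(ℝ, E) x).symm u))) h2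

/-- The Lie bracket in the chart around the base point. -/
theorem chartD_mlieBracket (x : M) (X Z : ∀ x : M, TangentSpace 𝓘(ℝ, E) x) :
    tangentCoord x (VectorField.mlieBracket 𝓘(ℝ, E) X Z x) =
      VectorField.lieBracket ℝ (fieldCoord x X) (fieldCoord x Z) (extChartAt 𝓘(ℝ, E) x x) := by
  have hx := mem_chart_source E x
  have h0 := Filter.EventuallyEq.lieBracket_vectorField_eq (𝕜 := ℝ) (mpullbackWithin_chart_symm x X)
    (mpullbackWithin_chart_symm x Z)
  have h1 : ((extChartAt 𝓘(ℝ, E) x).symm ⁻¹' univ ∩ range 𝓘(ℝ, E) : Set E) = univ := by simp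
  have h2 : (VectorField.mlieBracket 𝓘(ℝ, E) X Z x : E) = (chartD x x : E →L[ℝ] E).inverse
    (VectorField.lieBracketWithin ℝ
      (VectorField.mpullbackWithin 𝓘(ℝ, E) 𝓘(ℝ, E) (extChartAt 𝓘(ℝ, E) x).symm X (range 𝓘(ℝ, E)))
      (VectorField.mpullbackWithin 𝓘(ℝ, E) 𝓘(ℝ, E) (extChartAt 𝓘(ℝ, E) x).symm Z (range 𝓘(ℝ, E)))
      ((extChartAt 𝓘(ℝ, E) x).symm ⁻¹' univ ∩ range 𝓘(ℝ, E)) (extChartAt 𝓘(ℝ, E) x x)) := rfl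
  rw [h1, inverse_chartD hx] at h2
  exact ((congrArg (fun v : E => (chartD x x : E →L[ℝ] E) v) h2).trans
    (chartD_chartDSymm hx _)).trans ((congrFun VectorField.lieBracketWithin_univ _).trans h0)

theorem trivializationAt_tangent_snd {x₀ x : M} (hx : x ∈ (chartAt E x₀).source)
    (v : TangentSpace 𝓘(ℝ, E) x) :
    (trivializationAt E (TangentSpace 𝓘(ℝ, E) : M → Type _) x₀ ⟨x, v⟩).2 =
      (chartD x₀ x : E →L[ℝ] E) v := by
  have h := TangentBundle.continuousLinearMapAt_trivializationAt (I := 𝓘(ℝ, E)) hx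
  have h2 := congrArg (fun T : E →L[ℝ] E => T v) h
  refine Eq.trans ?_ h2
  exact Eq.symm <|
    (trivializationAt E (TangentSpace 𝓘(ℝ, E) : M → Type _) x₀).continuousLinearMapAt_apply_of_mem
      ℝ hx v

/-- A smooth vector field is differentiable in coordinates. -/
theorem SmoothNear.differentiableAt {x : M} {Y : ∀ x : M, TangentSpace 𝓘(ℝ, E) x}
    (hY : SmoothNear Y x) :
    DifferentiableAt ℝ (fieldCoord x Y) (extChartAt 𝓘(ℝ, E) x x) := by
  obtain ⟨U, hU, h⟩ := hY
  have h1 := ((Bundle.contMDiffAt_section x).1 (h.contMDiffAt hU)).mdifferentiableAt (by simp)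
  have hx := mem_chart_source E x
  have h2 : MDifferentiableAt 𝓘(ℝ, E) 𝓘(ℝ, E) (fun x' => tangentCoord x (Y x')) x := by
    refine h1.congr_of_eventuallyEq ?_
    filter_upwards [(chartAt E x).open_source.mem_nhds hx] with x' hx'
    exact (trivializationAt_tangent_snd hx' (Y x')).symm
  have h3 : MDifferentiableAt 𝓘(ℝ, E) 𝓘(ℝ, E) (fun x' => tangentCoord x (Y x'))
      ((extChartAt 𝓘(ℝ, E) x).symm (extChartAt 𝓘(ℝ, E) x x)) := by
    rwa [left_inv_chart hx]
  exact (h3.comp _ (hasMFDerivAt_chart_symm hx).mdifferentiableAt).differentiableAt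

/-- The local vector field which is constant, equal to `v`, in the chart around `x₀`. -/
def constField (x₀ : M) (v : E) (x : M) : TangentSpace 𝓘(ℝ, E) x :=
  (chartDSymm x₀ x : E →L[ℝ] E) v

theorem tangentCoord_constField {x₀ x : M} (hx : x ∈ (chartAt E x₀).source) (v : E) :
    tangentCoord x₀ (constField x₀ v x) = v :=
  chartD_chartDSymm hx v

theorem smoothNear_constField (x : M) (v : E) : SmoothNear (constField (E := E) x v) x := by
  refine ⟨(chartAt E x).source, (chartAt E x).open_source.mem_nhds (mem_chart_source E x), ?_⟩
  set e := trivializationAt E (TangentSpace 𝓘(ℝ, E) : M → Type _) x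
  refine (e.contMDiffOn_section_baseSet_iff (IB := 𝓘(ℝ, E)) (n := ∞)).2 ?_
  refine (contMDiffOn_const (c := v)).congr fun x' hx' => ?_
  exact (trivializationAt_tangent_snd hx' _).trans (chartD_chartDSymm hx' v)

/-! ### Affine jets -/

section Push

variable {b : LocalBisection E M} {A : J11 E M} {x y : M}

/-- The value and the derivative of the image `bY` of a vector field under a bisection with jet
`A`, in coordinates: if `b` is given by a map `β` and linear maps `Φ`, then
`(bY)(β(u)) = Φ(u)(Y(u))`, so that `D(bY)(β' v) = (Φ' v)(Y) + Φ(Y' v)`. -/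
theorem Represents.hasFDerivAt_push (h : Represents b A) (hx : A.src = x) (hy : A.tgt.tgt = y)
    {Y : ∀ x : M, TangentSpace 𝓘(ℝ, E) x} {Y' : E →L[ℝ] E}
    (hY : HasFDerivAt (fieldCoord x Y) Y' (extChartAt 𝓘(ℝ, E) x x)) :
    fieldCoord y (b.push Y) (extChartAt 𝓘(ℝ, E) y y) =
      coordLin x y A.tgt (fieldCoord x Y (extChartAt 𝓘(ℝ, E) x x)) ∧
    ∃ Z' : E →L[ℝ] E, HasFDerivAt (fieldCoord y (b.push Y)) Z' (extChartAt 𝓘(ℝ, E) y y) ∧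
      ∀ v, Z' (coordBase x y A v) =
        coordHess x y A v (fieldCoord x Y (extChartAt 𝓘(ℝ, E) x x)) +
          coordLin x y A.tgt (Y' v) := by
  have hbx : b.base x = y := by rw [← hx, h.base_eq, hy]
  have hxs : x ∈ b.base.source := hx ▸ h.1
  have hys : y ∈ b.base.target := hbx ▸ b.base.map_source hxs
  have hinv : b.base.symm y = x := by rw [← hbx]; exact b.base.left_inv hxs
  have hxc : A.src ∈ (chartAt E x).source := hx ▸ mem_chart_source E x
  have hyc : A.tgt.tgt ∈ (chartAt E y).source := hy ▸ mem_chart_source E y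
  have hcx := mem_chart_source E x
  have hcy := mem_chart_source E y
  -- the inverse of the base map, in coordinates
  set G : E → E := fun w => extChartAt 𝓘(ℝ, E) x (b.base.symm ((extChartAt 𝓘(ℝ, E) y).symm w))
    with hG
  have hG0 : G (extChartAt 𝓘(ℝ, E) y y) = extChartAt 𝓘(ℝ, E) x x := by
    simp only [hG, left_inv_chart hcy, hinv]
  have hsymm : ContMDiffAt 𝓘(ℝ, E) 𝓘(ℝ, E) ∞ b.base.symm y :=
    b.base.symm.contMDiffOn.contMDiffAt (b.base.symm.open_source.mem_nhds hys)
  have hGd : DifferentiableAt ℝ G (extChartAt 𝓘(ℝ, E) y y) := by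
    have h1 : MDifferentiableAt 𝓘(ℝ, E) 𝓘(ℝ, E) (extChartAt 𝓘(ℝ, E) x) (b.base.symm y) := by
      rw [hinv]; exact mdifferentiableAt_extChartAt hcx
    have h2 := h1.comp y (hsymm.mdifferentiableAt (by simp))
    rw [← left_inv_chart hcy] at h2
    exact (h2.comp _ (hasMFDerivAt_chart_symm hcy).mdifferentiableAt).differentiableAt
  have hβ := h.hasFDerivAt_base hxc hyc
  have hΦ := h.hasFDerivAt_lin hxc hyc
  rw [hx] at hβ hΦ
  set β : E → E := fun u => extChartAt 𝓘(ℝ, E) y (b.base ((extChartAt 𝓘(ℝ, E) x).symm u)) with hβdef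
  have hβ0 : β (extChartAt 𝓘(ℝ, E) x x) = extChartAt 𝓘(ℝ, E) y y := by
    simp only [hβdef, left_inv_chart hcx, hbx]
  have hΦ0 : b.toJ1 ((extChartAt 𝓘(ℝ, E) x).symm (extChartAt 𝓘(ℝ, E) x x)) = A.tgt := by
    rw [left_inv_chart hcx, h.tgt_eq, ← hx]; rfl
  have hev : ∀ᶠ x' in 𝓝 x, x' ∈ b.base.source ∧ x' ∈ (chartAt E x).source ∧
      b.base x' ∈ (chartAt E y).source := b.eventually_mem hxs hcx (hbx ▸ hcy)
  have hGβ : G ∘ β =ᶠ[𝓝 (extChartAt 𝓘(ℝ, E) x x)] id := by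
    filter_upwards [continuousAt_chart_symm hcx hev,
      (isOpen_extChartAt_target (I := 𝓘(ℝ, E)) x).mem_nhds (mem_extChartAt_target x)] with u hu hu'
    obtain ⟨h1, h2, h3⟩ : _ ∈ b.base.source ∧ _ ∈ (chartAt E x).source ∧ _ := hu
    have h4 : b.base.symm (b.base ((extChartAt 𝓘(ℝ, E) x).symm u)) =
      (extChartAt 𝓘(ℝ, E) x).symm u := b.base.left_inv h1
    simp only [Function.comp_apply, hG, hβdef, left_inv_chart h3, h4, id_eq,
      PartialEquiv.right_inv _ hu']
  have hG' : HasFDerivAt G (fderiv ℝ G (extChartAt 𝓘(ℝ, E) y y))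
      (β (extChartAt 𝓘(ℝ, E) x x)) := by
    rw [hβ0]; exact hGd.hasFDerivAt
  -- the derivative of `G` at the target is left inverse to the one of `β`
  have hGβ' : ∀ v, fderiv ℝ G (extChartAt 𝓘(ℝ, E) y y) (coordBase x y A v) = v := by
    have := ((hG'.comp _ hβ).congr_of_eventuallyEq hGβ.symm).unique (hasFDerivAt_id _)
    exact fun v => congrArg (fun T : E →L[ℝ] E => T v) this
  have hpush : fieldCoord y (b.push Y) =ᶠ[𝓝 (extChartAt 𝓘(ℝ, E) y y)] fun w =>
      coordLin x y (b.toJ1 ((extChartAt 𝓘(ℝ, E) x).symm (G w))) (fieldCoord x Y (G w)) := by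
    have h1 : ∀ᶠ y' in 𝓝 y, b.base.symm y' ∈ (chartAt E x).source :=
      hsymm.continuousAt (by rw [hinv]; exact (chartAt E x).open_source.mem_nhds hcx)
    filter_upwards [continuousAt_chart_symm hcy h1,
      continuousAt_chart_symm hcy (b.base.open_target.mem_nhds hys)] with w hw hw'
    have h2 : b.base.symm ((extChartAt 𝓘(ℝ, E) y).symm w) ∈ (chartAt E x).source := hw
    have h3 : b.base (b.base.symm ((extChartAt 𝓘(ℝ, E) y).symm w)) =
      (extChartAt 𝓘(ℝ, E) y).symm w := b.base.right_inv hw'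
    have h4 : (extChartAt 𝓘(ℝ, E) x).symm (G w) =
        b.base.symm ((extChartAt 𝓘(ℝ, E) y).symm w) := left_inv_chart h2
    -- the values of `Y` are moved to the model space, where the linear maps are defined
    let Z : M → E := Y
    change (chartD y _ : E →L[ℝ] E) (b.endo (b.base.symm ((extChartAt 𝓘(ℝ, E) y).symm w))
        (Z (b.base.symm ((extChartAt 𝓘(ℝ, E) y).symm w)))) =
      coordLin x y (b.toJ1 ((extChartAt 𝓘(ℝ, E) x).symm (G w)))
        (chartD x ((extChartAt 𝓘(ℝ, E) x).symm (G w)) (Z ((extChartAt 𝓘(ℝ, E) x).symm (G w))))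
    rw [h4]
    simp only [coordLin, b.toJ1_eq, mk1_src, mk1_tgt, mk1_endo,
      ContinuousLinearMap.comp_apply, chartDSymm_chartD h2, h3]
  have hval : fieldCoord y (b.push Y) (extChartAt 𝓘(ℝ, E) y y) =
      coordLin x y A.tgt (fieldCoord x Y (extChartAt 𝓘(ℝ, E) x x)) := by
    refine hpush.eq_of_nhds.trans ?_
    simp only [hG0, hΦ0]
  refine ⟨hval, ?_⟩
  have h1 := hΦ.clm_apply hY
  rw [hΦ0] at h1
  have h2 : HasFDerivAt (fun u => coordLin x y (b.toJ1 ((extChartAt 𝓘(ℝ, E) x).symm u))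
      (fieldCoord x Y u)) ((coordLin x y A.tgt).comp Y' +
      (coordHess x y A).flip (fieldCoord x Y (extChartAt 𝓘(ℝ, E) x x)))
      (G (extChartAt 𝓘(ℝ, E) y y)) := by
    rw [hG0]; exact h1
  have h3 := HasFDerivAt.comp (𝕜 := ℝ) (extChartAt 𝓘(ℝ, E) y y) h2 hGd.hasFDerivAt
  refine ⟨_, h3.congr_of_eventuallyEq hpush, fun v => ?_⟩
  simp only [ContinuousLinearMap.comp_apply, hGβ', add_apply, ContinuousLinearMap.flip_apply]
  exact add_comm _ _

end Push

theorem SymmetryJet.represents_rep (s : SymmetryJet E M) (x : M) :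
    Represents (s.rep x) (s.toFun x : J11 E M) :=
  Classical.choose_spec (s.toFun x).2.1

/-- The connection of a symmetry jet in coordinates: `∇_X Y = DY(X) - ½ σ(X, Y)`. -/
theorem SymmetryJet.chartD_nabla (s : SymmetryJet E M) {x : M}
    (X : ∀ x : M, TangentSpace 𝓘(ℝ, E) x) {Y : ∀ x : M, TangentSpace 𝓘(ℝ, E) x} {Y' : E →L[ℝ] E}
    (hY : HasFDerivAt (fieldCoord x Y) Y' (extChartAt 𝓘(ℝ, E) x x)) :
    tangentCoord x (s.nabla X Y x) = Y' (tangentCoord x (X x)) -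
      (1 / 2 : ℝ) • s.hess x x (tangentCoord x (X x)) (tangentCoord x (Y x)) := by
  have hx := mem_chart_source E x
  obtain ⟨h0, Z', hZ', h1⟩ := (s.represents_rep x).hasFDerivAt_push (s.source_eq x)
    (y := x) (by rw [s.tgt_eq]; rfl) hY
  rw [s.coordLin_eq hx] at h0
  simp only [s.coordLin_eq hx, s.coordBase_eq hx] at h1
  have hadd : fieldCoord x (Y + (s.rep x).push Y) =
      fieldCoord x Y + fieldCoord x ((s.rep x).push Y) := by
    funext u
    exact tangentCoord_add x _ _
  have hd := hY.add hZ'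
  rw [← hadd] at hd
  -- the field `Y + s_x Y` vanishes at `x`, so that the bracket with `X` is its derivative along `X`
  have hzero : fieldCoord x (Y + (s.rep x).push Y) (extChartAt 𝓘(ℝ, E) x x) = 0 := by
    rw [hadd, Pi.add_apply, h0]
    simp
  have h2 := chartD_mlieBracket x X (Y + (s.rep x).push Y)
  rw [VectorField.lieBracket, hd.fderiv, hzero, map_zero, sub_zero] at h2
  have h3 : tangentCoord x (s.nabla X Y x) = (1 / 2 : ℝ) • tangentCoord x
      (VectorField.mlieBracket 𝓘(ℝ, E) X (Y + (s.rep x).push Y) x) :=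
    tangentCoord_smul x (1 / 2 : ℝ) _
  have h4 := h1 (fieldCoord x X (extChartAt 𝓘(ℝ, E) x x))
  simp only [neg_apply, ContinuousLinearMap.id_apply, map_neg] at h4
  rw [h3, h2, add_apply, neg_eq_iff_eq_neg.1 h4, fieldCoord_self, fieldCoord_self,
    SymmetryJet.hess]
  module

/-- The condition of affinity for given vector fields says that the Hessian of the jet agrees
with the Hessian of the affine extension on their values. -/
theorem SymmetryJet.nabla_push_iff (s : SymmetryJet E M) {A : J11 E M}
    (hA : A ∈ SemiHolonomic E M) {b : LocalBisection E M} (hb : Represents b A)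
    {X Y X' : ∀ x : M, TangentSpace 𝓘(ℝ, E) x} (hY : SmoothNear Y A.src)
    (hX' : X' (b.base A.src) = b.lin A.src (X A.src)) :
    b.lin A.src (s.nabla X Y A.src) = s.nabla X' (b.push Y) (b.base A.src) ↔
      coordHess A.src A.tgt.tgt A (tangentCoord A.src (X A.src)) (tangentCoord A.src (Y A.src)) =
      s.extHess A.src A.tgt.tgt A.tgt (tangentCoord A.src (X A.src))
        (tangentCoord A.src (Y A.src)) := by
  have hx := mem_chart_source E A.src
  have hy := mem_chart_source E A.tgt.tgt
  have hb0 := hb.base_eq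
  have hY' := hY.differentiableAt.hasFDerivAt
  obtain ⟨h0, Z', hZ', h1⟩ := hb.hasFDerivAt_push rfl rfl hY'
  have h2 := s.chartD_nabla X hY'
  have h3 := s.chartD_nabla X' hZ'
  have htgt : b.toJ1 A.src = A.tgt := by rw [hb.tgt_eq]; rfl
  have hlin : ∀ v : TangentSpace 𝓘(ℝ, E) A.src, tangentCoord A.tgt.tgt (b.lin A.src v) =
      coordLin A.src A.tgt.tgt A.tgt (tangentCoord A.src v) := fun v => by
    rw [tangentCoord_lin b _ hx, htgt]
  have hXv : tangentCoord A.tgt.tgt (X' A.tgt.tgt) =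
      coordLin A.src A.tgt.tgt A.tgt (tangentCoord A.src (X A.src)) := by
    rw [← hlin, ← hX', hb0]
  have e1 : b.lin A.src (s.nabla X Y A.src) = s.nabla X' (b.push Y) (b.base A.src) ↔
      tangentCoord A.tgt.tgt (b.lin A.src (s.nabla X Y A.src)) =
      tangentCoord A.tgt.tgt (s.nabla X' (b.push Y) A.tgt.tgt) := by
    rw [← hb0]
    exact (tangentCoord_injective (mem_chart_source E (b.base A.src))).eq_iff.symm
  -- with these values, the condition is `φ(DY(X) - ½ σ(X, Y)) = B(X, Y) + φ(DY(X)) - ½ σ(φ X, φ Y)`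
  have h4 := h1 (tangentCoord A.src (X A.src))
  rw [SemiHolonomic.coordBase_eq hA hx hy, fieldCoord_self] at h4
  have h5 : tangentCoord A.tgt.tgt (b.push Y A.tgt.tgt) =
      coordLin A.src A.tgt.tgt A.tgt (tangentCoord A.src (Y A.src)) := by
    rw [← fieldCoord_self, h0, fieldCoord_self]
  rw [e1, hlin, h2, h3, hXv, h4, h5, s.extHess_apply, B11.tgt_src hA.1, map_sub, map_smul]
  constructor
  · intro h
    linear_combination (norm := module) -h
  · intro h
    linear_combination (norm := module) -h

section Affine

variable [FiniteDimensional ℝ E] (s : SymmetryJet E M)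

/-- The values of the affine extension are affine jets. -/
theorem SymmetryJet.isAffine_extension (ξ : GLTM E M) : IsAffine s (s.extension ξ) := by
  rintro b hb x rfl X Y X' - hY - hX'
  rw [s.nabla_push_iff (s.extension ξ).2 hb hY hX', s.coordHess_extension, s.extension_tgt]
  · rw [s.extension_src]; exact mem_chart_source E _
  · rw [s.extension_tgt]; exact mem_chart_source E _

/-- Every affine jet is a value of the affine extension: testing affinity on fields which are
constant in a chart determines the Hessian. -/
theorem SymmetryJet.eq_extension_of_isAffine {A : SemiHolonomic E M} (hA : IsAffine s A) :
    ∃ ξ, s.extension ξ = A := by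
  obtain ⟨b, hb⟩ := A.2.1
  have hs := B11.tgt_src A.2.1
  have hinv : (A : J11 E M).tgt.lin.IsInvertible := by
    rw [hb.tgt_eq]; exact b.invertible _ hb.1
  have hb0 := hb.base_eq
  refine ⟨⟨(A : J11 E M).tgt, hinv⟩, (s.eq_extension (x₀ := (A : J11 E M).src)
    (y₀ := (A : J11 E M).tgt.tgt) rfl ?_ (mem_chart_source E _) ?_).symm⟩
  · rw [← hs]; exact mem_chart_source E _
  ext v w
  have hx := mem_chart_source E (A : J11 E M).src
  set X' := constField (b.base (A : J11 E M).src) (tangentCoord (b.base (A : J11 E M).src)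
    (b.lin (A : J11 E M).src (constField (A : J11 E M).src v (A : J11 E M).src)))
  have h1 : X' (b.base (A : J11 E M).src) =
      b.lin (A : J11 E M).src (constField (A : J11 E M).src v (A : J11 E M).src) :=
    tangentCoord_injective (mem_chart_source E _) (tangentCoord_constField (mem_chart_source E _) _)
  have h2 := (s.nabla_push_iff A.2 hb (smoothNear_constField _ w) h1).1
    (hA b hb _ rfl _ _ X' (smoothNear_constField _ v) (smoothNear_constField _ w)
      (smoothNear_constField _ _) h1)
  rwa [tangentCoord_constField hx, tangentCoord_constField hx] at h2

end Affine

/-! ### Genuine 2-jets -/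

/-- The derivative of a map of `M` in coordinates. -/
theorem hasFDerivAt_coord_of_mdifferentiableAt {f : M → M} {x x₀ y₀ : M}
    (hf : MDifferentiableAt 𝓘(ℝ, E) 𝓘(ℝ, E) f x) (hx : x ∈ (chartAt E x₀).source)
    (hy : f x ∈ (chartAt E y₀).source) :
    HasFDerivAt (fun u => extChartAt 𝓘(ℝ, E) y₀ (f ((extChartAt 𝓘(ℝ, E) x₀).symm u)))
      (coordLin x₀ y₀ (mk1 x (f x) (mfderiv 𝓘(ℝ, E) 𝓘(ℝ, E) f x)))
      (extChartAt 𝓘(ℝ, E) x₀ x) := by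
  have h4 := HasMFDerivAt.comp x (hasMFDerivAt_chart hy) hf.hasMFDerivAt
  rw [← left_inv_chart hx] at h4
  have h5 := HasMFDerivAt.comp _ h4 (hasMFDerivAt_chart_symm hx)
  rw [hasMFDerivAt_iff_hasFDerivAt] at h5
  convert! h5 using 1
  rw [left_inv_chart hx]
  rfl

/-- The Hessian of a genuine 2-jet is the second derivative of a map, hence symmetric. -/
theorem IsHolonomic.coordHess_symm {A : J11 E M} (h : IsHolonomic A) {x₀ y₀ : M}
    (hx : A.src ∈ (chartAt E x₀).source) (hy : A.tgt.tgt ∈ (chartAt E y₀).source) (v w : E) :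
    coordHess x₀ y₀ A v w = coordHess x₀ y₀ A w v := by
  obtain ⟨b, hb, hr⟩ := h
  set β : E → E := fun u => extChartAt 𝓘(ℝ, E) y₀ (b.base ((extChartAt 𝓘(ℝ, E) x₀).symm u))
  have hbase : b.base A.src ∈ (chartAt E y₀).source := by rwa [hr.base_eq]
  have h1 := continuousAt_chart_symm hx (b.eventually_mem hr.1 hx hbase)
  -- holonomy of the bisection says that its linear part is the derivative of its base map
  have h2 : fderiv ℝ β =ᶠ[𝓝 (extChartAt 𝓘(ℝ, E) x₀ A.src)]
      fun u => coordLin x₀ y₀ (b.toJ1 ((extChartAt 𝓘(ℝ, E) x₀).symm u)) := by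
    filter_upwards [h1, (isOpen_extChartAt_target x₀).mem_nhds (chart_mem_target hx)] with u hu hu'
    obtain ⟨h3, h4, h5⟩ : _ ∈ b.base.source ∧ _ ∈ (chartAt E x₀).source ∧ _ := hu
    have h6 := hasFDerivAt_coord_of_mdifferentiableAt
      ((b.contMDiffAt_base h3).mdifferentiableAt (by simp)) h4 h5
    rw [PartialEquiv.right_inv _ hu'] at h6
    refine h6.fderiv.trans ?_
    rw [b.toJ1_eq]
    congr 2
    exact (hb _ h3).symm
  have h3 : ContDiffAt ℝ ∞ β (extChartAt 𝓘(ℝ, E) x₀ A.src) := by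
    have hs : ContMDiffAt 𝓘(ℝ, E) 𝓘(ℝ, E) ∞ (extChartAt 𝓘(ℝ, E) x₀).symm
        (extChartAt 𝓘(ℝ, E) x₀ A.src) :=
      (contMDiffOn_extChartAt_symm x₀).contMDiffAt
        ((isOpen_extChartAt_target x₀).mem_nhds (chart_mem_target hx))
    have ht : ContMDiffAt 𝓘(ℝ, E) 𝓘(ℝ, E) ∞ (extChartAt 𝓘(ℝ, E) y₀) (b.base A.src) :=
      contMDiffAt_extChartAt' hbase
    have h4 := ht.comp A.src (b.contMDiffAt_base hr.1)
    rw [← left_inv_chart hx] at h4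
    exact (h4.comp _ hs).contDiffAt
  have h4 : fderiv ℝ (fderiv ℝ β) (extChartAt 𝓘(ℝ, E) x₀ A.src) = coordHess x₀ y₀ A :=
    h2.fderiv_eq.trans (hr.hasFDerivAt_lin hx hy).fderiv
  rw [← h4]
  exact h3.isSymmSndFDerivAt (by
    rw [minSmoothness_of_isRCLikeNormedField]
    exact WithTop.coe_le_coe.2 (le_top : (2 : ℕ∞) ≤ ⊤)) v w

theorem coordLin_mk1_injective {x y x₀ y₀ : M} (hx : x ∈ (chartAt E x₀).source)
    (hy : y ∈ (chartAt E y₀).source) {φ ψ : E →L[ℝ] E}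
    (h : coordLin x₀ y₀ (mk1 x y φ) = coordLin x₀ y₀ (mk1 x y ψ)) : φ = ψ := by
  have h1 : jetChart x₀ y₀ (mk1 x y φ) = jetChart x₀ y₀ (mk1 x y ψ) := by
    rw [jetChart_mk1 hx hy, jetChart_mk1 hx hy]
    exact Prod.ext rfl h
  exact congrArg OneJet.endo (jetChart_injOn (JetGroupoid.mem_jetChart_source.2 ⟨hx, hy⟩)
    (JetGroupoid.mem_jetChart_source.2 ⟨hx, hy⟩) h1)

/-- A quadratic map with prescribed derivatives. -/
theorem hasFDerivAt_quadratic (c u₀ : E) (φ : E →L[ℝ] E) {B : E →L[ℝ] E →L[ℝ] E}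
    (hB : ∀ v w, B v w = B w v) (u : E) :
    HasFDerivAt (fun u => c + φ (u - u₀) + (1 / 2 : ℝ) • B (u - u₀) (u - u₀))
      (φ + B (u - u₀)) u := by
  have h0 := (hasFDerivAt_id (𝕜 := ℝ) u).sub_const u₀
  have h1 := φ.hasFDerivAt.comp u h0
  have h2 := (B.hasFDerivAt.comp u h0).clm_apply h0
  refine ((h1.const_add c).add (h2.const_smul (1 / 2 : ℝ))).congr_fderiv ?_
  ext v
  simp [hB v]
  module

section Extension

variable [FiniteDimensional ℝ E] (s : SymmetryJet E M)

/-- If `𝔰` is holonomic, then the Hessian `B` of `S(ξ)` is symmetric, and `S(ξ)` is the 2-jet of the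
map `u ↦ φ u + ½ B(u, u)` in coordinates centred at the source and the target. -/
theorem SymmetryJet.isHolonomic_extension (hs : s.IsHolonomic) (ξ : GLTM E M) :
    JetGroupoid.IsHolonomic (s.extension ξ : J11 E M) := by
  have : CompleteSpace E := FiniteDimensional.complete ℝ E
  let x := (ξ : J1 E M).src
  let y := (ξ : J1 E M).tgt
  have hσ : ∀ (x : M) (v w : E), s.hess x x v w = s.hess x x w v := fun x v w =>
    (hs x).coordHess_symm (by rw [s.source_eq]; exact mem_chart_source E x)
      (by rw [s.tgt_eq]; exact mem_chart_source E x) v w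
  set φ := coordLin x y (ξ : J1 E M) with hφ
  set B := s.extHess x y (ξ : J1 E M) with hBdef
  have hB : ∀ v w, B v w = B w v := fun v w => by
    rw [hBdef, s.extHess_apply, s.extHess_apply, hσ y, hσ x]
  set u₀ := extChartAt 𝓘(ℝ, E) x x with hu₀
  have hβ := hasFDerivAt_quadratic (extChartAt 𝓘(ℝ, E) y y) u₀ φ hB
  have hΦ : HasFDerivAt (fun u => φ + B (u - u₀)) B u₀ := by
    simpa using (B.hasFDerivAt.comp u₀ ((hasFDerivAt_id u₀).sub_const u₀)).const_add φ
  have hsub : ContDiff ℝ ∞ (fun u : E => u - u₀) := contDiff_id.sub contDiff_const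
  have hBs : ContDiff ℝ ∞ (fun u : E => B (u - u₀)) := B.contDiff.comp hsub
  have hβs : ContDiff ℝ ∞ (fun u => extChartAt 𝓘(ℝ, E) y y + φ (u - u₀) +
      (1 / 2 : ℝ) • B (u - u₀) (u - u₀)) :=
    (contDiff_const.add (φ.contDiff.comp hsub)).add ((hBs.clm_apply hsub).const_smul (1 / 2 : ℝ))
  have hβ₀ := hβ u₀
  rw [sub_self, map_zero, add_zero] at hβ₀
  obtain ⟨b, h1, h2, h3, h4, h5⟩ := exists_localBisection_jet (GLTM.isInvertible ξ) hβs
    (contDiff_const.add hBs) (by simp [hu₀, x, y]) hβ₀ (by simp [hφ, hu₀, x, y]) hΦ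
  -- the jet of the constructed bisection is `S(ξ)`; its linear part is `φ + B u = dβ`
  have h6 := s.eq_extension (A := ⟨b.jet x, h2⟩) (ξ := ξ) h3 (mem_chart_source E x)
    (mem_chart_source E y) h4
  rw [← h6]
  refine ⟨b, fun x' hx' => ?_, h1⟩
  obtain ⟨h7, h8, h9⟩ := h5 x' hx'
  refine coordLin_mk1_injective h7 h8 (φ := b.endo x') ?_
  have h10 := hasFDerivAt_coord_of_mdifferentiableAt
    ((b.contMDiffAt_base hx').mdifferentiableAt (by simp)) h7 h8
  refine Eq.trans ?_ ((h10.congr_of_eventuallyEq ?_).unique (hβ _)).symm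
  · rw [b.toJ1_eq, jetChart_mk1 h7 h8] at h9
    exact congrArg Prod.snd h9
  · have h11 := continuousAt_chart_symm h7 (b.base.open_source.mem_nhds hx')
    filter_upwards [h11, (isOpen_extChartAt_target x).mem_nhds (chart_mem_target h7)] with u hu hu'
    obtain ⟨h12, h13, h14⟩ := h5 _ hu
    rw [b.toJ1_eq, jetChart_mk1 h12 h13, PartialEquiv.right_inv _ hu'] at h14
    exact (congrArg (fun q => q.1.2) h14).symm

end Extension

end JetGroupoid

end

theorem proposition3p3
    (E : Type*) [NormedAddCommGroup E] [NormedSpace ℝ E] [FiniteDimensional ℝ E]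
    (M : Type*) [TopologicalSpace M] [ChartedSpace E M] [IsManifold 𝓘(ℝ, E) ∞ M]
    (s : JetGroupoid.SymmetryJet E M) :
    ∃ S : JetGroupoid.GLTM E M → JetGroupoid.SemiHolonomic E M,
      JetGroupoid.IsAffineExtension s S ∧
      (∀ S' : JetGroupoid.GLTM E M → JetGroupoid.SemiHolonomic E M,
        JetGroupoid.IsAffineExtension s S' → S' = S) ∧
      Set.range S = {A | JetGroupoid.IsAffine s A} ∧
      (s.IsHolonomic → ∀ ξ, JetGroupoid.IsHolonomic (S ξ : JetGroupoid.J11 E M)) := by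
  refine ⟨s.extension, s.isAffineExtension, fun S' h => s.extension_unique h,
    Set.Subset.antisymm ?_ fun A hA => s.eq_extension_of_isAffine hA,
    s.isHolonomic_extension⟩
  rintro _ ⟨ξ, rfl⟩
  exact s.isAffine_extension ξ
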